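/- **Setting.** Let $J:\mathbb R^{M_1}\times\mathbb R^{M_2}\to\mathbb R$, write $z=\mathrm{col}\{x,y\}$, and let $\|\cdot\|$ be the Euclidean norm (spectral norm for matrices). Assume: 1. $J$ is twice continuously differentiable, $\|\nabla J(z_1)-\nabla J(z_2)\|\le L_f\|z_1-z_2\|$ and $\|\nabla^2J(z_1)-\nabla^2J(z_2)\|\le L_h\|z_1-z_2\|$ for all $z_1,z_2$, with $L_h\ge0$. 2. For a sample $\xi\sim\mathcal D$ the loss $Q(\cdot;\xi)$ is twice differentiable, and for all $z$: $\mathbb E\nabla Q(z;\xi)=\nabla J(z)$, $\mathbb E\nabla^2Q(z;\xi)=\nabla^2J(z)$, $\mathbb E\|\nabla Q(z;\xi)-\nabla J(z)\|^2\le\sigma^2$, $\mathbb E\|\nabla^2Q(z;\xi)-\nabla^2J(z)\|^2\le\sigma_h^2$, where $\sigma,\sigma_h\ge0$. 3. For every $x$ the maximum $P(x)=\max_yJ(x,y)$ is attained, $\|\nabla_yJ(x,y)\|^2\ge2\nu\,[P(x)-J(x,y)]$ for all $x,y$, and $P^\star=\inf_xP(x)>-\infty$. Here $0<\nu\le L_f$;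 put $\kappa=L_f/\nu\ge1$ and $L=L_f+L_f\kappa/2$. **Algorithm (AdaHMM with $\gamma=1$).** Let $\xi_{-1},\xi_0,\xi_1,\dots$ be samples of law $\mathcal D$, each independent of everything that precedes it. The starting points $(x_{-1},y_{-1})$ and $(x_0,y_0)$ may be random, and $m_{x,-1}=\nabla_xQ(x_{-1},y_{-1};\xi_{-1})$, $m_{y,-1}=\nabla_yQ(x_{-1},y_{-1};\xi_{-1})$. For $i=0,\dots,T-1$ ($T\ge1$): $$[h_{x,i};h_{y,i}]=\nabla^2Q(x_i,y_i;\xi_i)\begin{bmatrix}x_i-x_{i-1}\\y_i-y_{i-1}\end{bmatrix},$$ $$m_{x,i}=(1-\beta)[m_{x,i-1}+h_{x,i}]+\beta\nabla_xQ(x_i,y_i;\xi_i),\qquad m_{y,i}=(1-\beta)[m_{y,i-1}+h_{y,i}]+\beta\nabla_yQ(x_i,y_i;\xi_i),$$ $$x_{i+1}=x_i-\mu_x\frac{N_{x,i}^{-1}m_{x,i}}{\|N_{x,i}^{-1/2}m_{x,i}\|},\qquad y_{i+1}=y_i+\mu_y\frac{N_{y,i}^{-1}m_{y,i}}{\|N_{y,i}^{-1/2}m_{y,i}\|}$$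 (with $0/0=0$), where $N_{x,i}=\mathrm{diag}\{\sqrt{b_{x,i}}+\lambda\}$, $N_{y,i}=\mathrm{diag}\{\sqrt{b_{y,i}}+\lambda\}$, $\lambda>0$, and the entrywise nonnegative statistics $b_{x,i},b_{y,i}$ are computed by any rule (Adam, AdaGrad, ...) from the information available after $\xi_i$ is drawn. The output is $(x_\tau,y_\tau)$ with $\tau$ uniform on $\{0,\dots,T-1\}$, independent of the run. Assume there are constants $b\ge a>0$ with $aI\preceq N_{x,i}\preceq bI$ and $aI\preceq N_{y,i}\preceq bI$ almost surely for $0\le i<T$, that $\|x_0-x_{-1}\|\le\mu_x/\sqrt a$ and $\|y_0-y_{-1}\|\le\mu_y/\sqrt a$ almost surely (for instance $x_{-1}=x_0$, $y_{-1}=y_0$), and that $P(x_0)$ and $J(x_0,y_0)$ are integrable. Put $\Delta_0=P(x_0)-J(x_0,y_0)$, and let $y^o(x_0)$ be a maximizer of $J(x_0,\cdot)$ closest to $y_0$. **Theorem.** (i) If $\mu_x,\mu_y>0$, $\mu_x\le\frac{\sqrt a\,\mu_y}{6\sqrt b\,\kappa}$ and $0<\beta\le1$, then the gradient norms below are integrable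 and $$\frac1T\sum_{i=0}^{T-1}\mathbb E\big[\|\nabla_xJ(x_i,y_i)\|+\|\nabla_yJ(x_i,y_i)\|\big]\le\frac{3\sqrt b(\mathbb EP(x_0)-P^\star)}{\mu_xT}+\frac{20\sqrt bL_f\,\mathbb E\|y_0-y^o(x_0)\|}{\sqrt aT}+\frac{60b\kappa\,\mathbb E\Delta_0}{\sqrt a\mu_yT}$$ $$\qquad+C_1\mu_x+C_2\mu_y+C_3\Big(\frac{\sigma}{\beta T}+\frac{L_h(\mu_x^2+\mu_y^2)}{2a\beta}+\frac{\sqrt2\sigma_h\mu_y}{\sqrt{\beta a}}+\sigma\sqrt\beta\Big),$$ where $C_1=\frac{5\sqrt bL_f}{a}+\frac{10\sqrt bL_f\kappa}{a}+\frac{160bL_f\kappa}{a\sqrt a}+\frac{3\sqrt bL}{2a}$, $C_2=\frac{30bL_f\kappa}{a\sqrt a}+\frac{20\sqrt bL_f}{a}$, $C_3=\frac{160\kappa b}{a}+\frac{8\sqrt b}{\sqrt a}$, and $C_3=\mathcal O(\kappa b/a)$ with an absolute constant. (ii) Let $\sigma,\sigma_h>0$, and let $\delta,p>0$ be bounds $\mathbb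 E\Delta_0\le\delta$, $\mathbb EP(x_0)-P^\star\le p$ (for instance equalities). Choose $$\beta=\min\Big\{\frac{b\sigma}{aT^{2/3}},\frac{a^2}{\sigma^2b^2T^{2/3}},1\Big\},\quad\mu_y=\min\Big\{\frac{b\,\delta}{\sqrt a},\frac{\sqrt\sigma\,a}{\sigma_h\sqrt b\,T^{2/3}}\Big\},\quad\mu_x=\min\Big\{\frac{\sqrt a}{6\sqrt b\kappa}\mu_y,\frac{\sqrt b\,p}{T^{2/3}}\Big\}.$$ There is a constant $C>0$, depending only on $a,b,L_f,L_h,\sigma,\sigma_h,\delta,p$ (and not on $\nu$, $\kappa$, $T$, the dimensions or the problem), such that for every $T\ge1$: $\beta\le C/T^{2/3}$, $\mu_y\le C/T^{2/3}$, $\mu_x\le C/(\kappa T^{2/3})$, and $$\frac1T\sum_{i=0}^{T-1}\mathbb E\big[\|\nabla_xJ(x_i,y_i)\|+\|\nabla_yJ(x_i,y_i)\|\big]\le C\,\frac{\kappa}{T^{1/3}}.$$ (iii) With the same choices and the same $C$, for every $\varepsilon\in(0,1]$ there is $T_0\ge1$ such that $T_0$ iterations use at most $C\kappa^3\varepsilon^{-3}$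 samples (one per iteration and one for the initial momenta), and for every $T\ge T_0$ the output of $T$ iterations (with the parameters chosen for that $T$) is an $\varepsilon$-game stationary point: $\mathbb E\|\nabla_xJ(x_\tau,y_\tau)\|\le\varepsilon$ and $\mathbb E\|\nabla_yJ(x_\tau,y_\tau)\|\le\varepsilon$. -/

import Mathlib

open MeasureTheory ProbabilityTheory

namespace AdaHMM

noncomputable section

/-- The joint variable `z = col{x, y}` of `ℝ^{M₁} × ℝ^{M₂}`, with the Euclidean norm. -/
abbrev Joint (M₁ M₂ : ℕ) : Type :=
  WithLp 2 (EuclideanSpace ℝ (Fin M₁) × EuclideanSpace ℝ (Fin M₂))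

/-- `col{x, y}`. -/
abbrev col {M₁ M₂ : ℕ} (x : EuclideanSpace ℝ (Fin M₁)) (y : EuclideanSpace ℝ (Fin M₂)) :
    Joint M₁ M₂ :=
  WithLp.toLp 2 (x, y)

/-- The Hessian of `f` at `z`, as the linear map `v ↦ ∇²f(z) v`; its norm is the spectral norm. -/
def hessian {M₁ M₂ : ℕ} (f : Joint M₁ M₂ → ℝ) (z : Joint M₁ M₂) :
    Joint M₁ M₂ →L[ℝ] Joint M₁ M₂ :=
  fderiv ℝ (gradient f) z

/-- The partial gradient `∇ₓ f(x, y)`, the `x`-block of `∇_z f`. -/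
def gradX {M₁ M₂ : ℕ} (f : Joint M₁ M₂ → ℝ) (x : EuclideanSpace ℝ (Fin M₁))
    (y : EuclideanSpace ℝ (Fin M₂)) : EuclideanSpace ℝ (Fin M₁) :=
  (gradient f (col x y)).fst

/-- The partial gradient `∇_y f(x, y)`, the `y`-block of `∇_z f`. -/
def gradY {M₁ M₂ : ℕ} (f : Joint M₁ M₂ → ℝ) (x : EuclideanSpace ℝ (Fin M₁))
    (y : EuclideanSpace ℝ (Fin M₂)) : EuclideanSpace ℝ (Fin M₂) :=
  (gradient f (col x y)).snd

/-- The envelope `P(x) = max_y J(x, y)`. -/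
def envelope {M₁ M₂ : ℕ} (J : Joint M₁ M₂ → ℝ) (x : EuclideanSpace ℝ (Fin M₁)) : ℝ :=
  ⨆ y : EuclideanSpace ℝ (Fin M₂), J (col x y)

/-- `P⋆ = inf_x P(x)`. -/
def envelopeInf {M₁ M₂ : ℕ} (J : Joint M₁ M₂ → ℝ) : ℝ :=
  ⨅ x : EuclideanSpace ℝ (Fin M₁), envelope J x

/-- The set `Argmax_y J(x, y)`. -/
def maximizers {M₁ M₂ : ℕ} (J : Joint M₁ M₂ → ℝ) (x : EuclideanSpace ℝ (Fin M₁)) :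
    Set (EuclideanSpace ℝ (Fin M₂)) :=
  {y | ∀ y', J (col x y') ≤ J (col x y)}

/-- `J` is twice continuously differentiable and `L_f`-smooth, with `L_h`-Lipschitz Hessian. -/
structure LipschitzCost {M₁ M₂ : ℕ} (J : Joint M₁ M₂ → ℝ) (Lf Lh : ℝ) : Prop where
  contDiff : ContDiff ℝ 2 J
  gradient_lipschitz : ∀ z₁ z₂, ‖gradient J z₁ - gradient J z₂‖ ≤ Lf * ‖z₁ - z₂‖
  hessian_lipschitz : ∀ z₁ z₂, ‖hessian J z₁ - hessian J z₂‖ ≤ Lh * ‖z₁ - z₂‖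

/-- `max_y J(x, y)` is attained, `-J(x, ·)` is `ν`-PL for every `x`, and the envelope is bounded
below. -/
structure PLCost {M₁ M₂ : ℕ} (J : Joint M₁ M₂ → ℝ) (ν : ℝ) : Prop where
  exists_max : ∀ x, (maximizers J x).Nonempty
  pl : ∀ x y, 2 * ν * (envelope J x - J (col x y)) ≤ ‖gradY J x y‖ ^ 2
  bddBelow : BddBelow (Set.range (envelope J))

/-- The stochastic loss `Q(z; s)`, `s ∼ D`, is twice differentiable in `z`, and its gradients and
Hessians are unbiased for those of `J`, with variances at most `σ²` and `σ_h²`. -/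
structure StochasticLoss {M₁ M₂ : ℕ} {Ξ : Type*} [MeasurableSpace Ξ]
    (Q : Joint M₁ M₂ → Ξ → ℝ) (D : Measure Ξ) (J : Joint M₁ M₂ → ℝ) (σ σh : ℝ) : Prop where
  differentiable : ∀ s, Differentiable ℝ (fun z => Q z s)
  differentiable_gradient : ∀ s, Differentiable ℝ (gradient (fun z => Q z s))
  measurable_gradient :
    Measurable fun p : Joint M₁ M₂ × Ξ => gradient (fun z => Q z p.2) p.1
  measurable_hessian :
    Measurable fun p : Joint M₁ M₂ × Ξ => hessian (fun z => Q z p.2) p.1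
  integrable_gradient : ∀ z, Integrable (fun s => gradient (fun z' => Q z' s) z) D
  integrable_hessian : ∀ z, Integrable (fun s => hessian (fun z' => Q z' s) z) D
  gradient_unbiased : ∀ z, ∫ s, gradient (fun z' => Q z' s) z ∂D = gradient J z
  hessian_unbiased : ∀ z, ∫ s, hessian (fun z' => Q z' s) z ∂D = hessian J z
  integrable_gradient_sq :
    ∀ z, Integrable (fun s => ‖gradient (fun z' => Q z' s) z - gradient J z‖ ^ 2) D
  integrable_hessian_sq :
    ∀ z, Integrable (fun s => ‖hessian (fun z' => Q z' s) z - hessian J z‖ ^ 2) D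
  gradient_variance :
    ∀ z, ∫ s, ‖gradient (fun z' => Q z' s) z - gradient J z‖ ^ 2 ∂D ≤ σ ^ 2
  hessian_variance :
    ∀ z, ∫ s, ‖hessian (fun z' => Q z' s) z - hessian J z‖ ^ 2 ∂D ≤ σh ^ 2

/-- The stochastic Hessian-vector product `∇²Q(z₁; s) (z₁ - z₂)`. -/
def hvp {M₁ M₂ : ℕ} {Ξ : Type*} (Q : Joint M₁ M₂ → Ξ → ℝ) (z₁ z₂ : Joint M₁ M₂) (s : Ξ) :
    Joint M₁ M₂ :=
  hessian (fun z => Q z s) z₁ (z₁ - z₂)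

/-- The diagonal of the scaling matrix `N = diag{√v + lam}`. -/
def scalingDiag {n : ℕ} (lam : ℝ) (v : EuclideanSpace ℝ (Fin n)) : Fin n → ℝ :=
  fun j => √(v j) + lam

/-- `diag{d}^p m` for a diagonal matrix with positive entries. -/
def diagPowMul {n : ℕ} (d : Fin n → ℝ) (p : ℝ) (m : EuclideanSpace ℝ (Fin n)) :
    EuclideanSpace ℝ (Fin n) :=
  WithLp.toLp 2 fun j => d j ^ p * m j

/-- The update direction `N⁻¹ m / ‖N^{-1/2} m‖` with `N = diag{d}`; it is `0` if `m = 0`. -/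
def direction {n : ℕ} (d : Fin n → ℝ) (m : EuclideanSpace ℝ (Fin n)) :
    EuclideanSpace ℝ (Fin n) :=
  ‖diagPowMul d (-1 / 2) m‖⁻¹ • diagPowMul d (-1) m

/-- The random sequences of a run: samples, iterates, momenta, second-order statistics.
Time starts at `-1`, so index `k` stands for time `k - 1`: `x 0`, `x 1`, `x 2` are
`x_{-1}`, `x_0`, `x_1`. -/
structure Trajectory (M₁ M₂ : ℕ) (Ω Ξ : Type*) where
  ξ : ℕ → Ω → Ξ
  x : ℕ → Ω → EuclideanSpace ℝ (Fin M₁)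
  y : ℕ → Ω → EuclideanSpace ℝ (Fin M₂)
  mx : ℕ → Ω → EuclideanSpace ℝ (Fin M₁)
  my : ℕ → Ω → EuclideanSpace ℝ (Fin M₂)
  vx : ℕ → Ω → EuclideanSpace ℝ (Fin M₁)
  vy : ℕ → Ω → EuclideanSpace ℝ (Fin M₂)

/-- `𝒯` is a run of `T` iterations of the algorithm with parameters `β, γ, μx, μy, lam`.

`ℱ k` is the information available before the sample of index `k` is drawn. The samples have law
`D`, and each is independent of the past. The momenta are started at the stochastic gradient at
`(x_{-1}, y_{-1})`. The second-order statistics may follow any strategy (Adam, AdaGrad, AMSGrad, …)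
that uses only the information available when they are formed. -/
structure IsRun {M₁ M₂ : ℕ} {Ω Ξ : Type*} [mΩ : MeasurableSpace Ω] [mΞ : MeasurableSpace Ξ]
    (Q : Joint M₁ M₂ → Ξ → ℝ) (D : Measure Ξ) (μ : Measure Ω) (ℱ : Filtration ℕ mΩ)
    (β γ μx μy lam : ℝ) (T : ℕ) (𝒯 : Trajectory M₁ M₂ Ω Ξ) : Prop where
  lam_pos : 0 < lam
  sample_measurable : ∀ k ≤ T, Measurable[ℱ (k + 1)] (𝒯.ξ k)
  sample_law : ∀ k ≤ T, μ.map (𝒯.ξ k) = D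
  sample_indep : ∀ k ≤ T, Indep (mΞ.comap (𝒯.ξ k)) (ℱ k) μ
  x_prev_measurable : Measurable[ℱ 0] (𝒯.x 0)
  y_prev_measurable : Measurable[ℱ 0] (𝒯.y 0)
  x_init_measurable : Measurable[ℱ 1] (𝒯.x 1)
  y_init_measurable : Measurable[ℱ 1] (𝒯.y 1)
  mx_init : ∀ ω, 𝒯.mx 0 ω = gradX (fun z => Q z (𝒯.ξ 0 ω)) (𝒯.x 0 ω) (𝒯.y 0 ω)
  my_init : ∀ ω, 𝒯.my 0 ω = gradY (fun z => Q z (𝒯.ξ 0 ω)) (𝒯.x 0 ω) (𝒯.y 0 ω)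
  mx_update : ∀ i < T, ∀ ω, 𝒯.mx (i + 1) ω =
    (1 - β) • (𝒯.mx i ω + γ • (hvp Q (col (𝒯.x (i + 1) ω) (𝒯.y (i + 1) ω))
        (col (𝒯.x i ω) (𝒯.y i ω)) (𝒯.ξ (i + 1) ω)).fst)
      + β • gradX (fun z => Q z (𝒯.ξ (i + 1) ω)) (𝒯.x (i + 1) ω) (𝒯.y (i + 1) ω)
  my_update : ∀ i < T, ∀ ω, 𝒯.my (i + 1) ω =
    (1 - β) • (𝒯.my i ω + γ • (hvp Q (col (𝒯.x (i + 1) ω) (𝒯.y (i + 1) ω))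
        (col (𝒯.x i ω) (𝒯.y i ω)) (𝒯.ξ (i + 1) ω)).snd)
      + β • gradY (fun z => Q z (𝒯.ξ (i + 1) ω)) (𝒯.x (i + 1) ω) (𝒯.y (i + 1) ω)
  vx_measurable : ∀ i < T, Measurable[ℱ (i + 2)] (𝒯.vx (i + 1))
  vy_measurable : ∀ i < T, Measurable[ℱ (i + 2)] (𝒯.vy (i + 1))
  vx_nonneg : ∀ i < T, ∀ ω j, 0 ≤ 𝒯.vx (i + 1) ω j
  vy_nonneg : ∀ i < T, ∀ ω j, 0 ≤ 𝒯.vy (i + 1) ω j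
  x_update : ∀ i < T, ∀ ω, 𝒯.x (i + 2) ω =
    𝒯.x (i + 1) ω - μx • direction (scalingDiag lam (𝒯.vx (i + 1) ω)) (𝒯.mx (i + 1) ω)
  y_update : ∀ i < T, ∀ ω, 𝒯.y (i + 2) ω =
    𝒯.y (i + 1) ω + μy • direction (scalingDiag lam (𝒯.vy (i + 1) ω)) (𝒯.my (i + 1) ω)

/-- `a I ⪯ diag{d} ⪯ b I`. -/
def DiagBetween {n : ℕ} (a b : ℝ) (d : Fin n → ℝ) : Prop :=
  (Matrix.diagonal d - a • (1 : Matrix (Fin n) (Fin n) ℝ)).PosSemidef ∧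
    (b • (1 : Matrix (Fin n) (Fin n) ℝ) - Matrix.diagonal d).PosSemidef

/-- All the scaling matrices of the run lie between `a I` and `b I`, almost surely. -/
def ScalingBounded {M₁ M₂ : ℕ} {Ω Ξ : Type*} [MeasurableSpace Ω] (μ : Measure Ω) (a b lam : ℝ)
    (T : ℕ) (𝒯 : Trajectory M₁ M₂ Ω Ξ) : Prop :=
  ∀ i < T, ∀ᵐ ω ∂μ, DiagBetween a b (scalingDiag lam (𝒯.vx (i + 1) ω)) ∧
    DiagBetween a b (scalingDiag lam (𝒯.vy (i + 1) ω))

/-- The two starting points are no further apart than one step of the algorithm can move them: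
`‖x_0 - x_{-1}‖ ≤ μx / √a` and `‖y_0 - y_{-1}‖ ≤ μy / √a`. -/
def StartClose {M₁ M₂ : ℕ} {Ω Ξ : Type*} [MeasurableSpace Ω] (μ : Measure Ω) (a μx μy : ℝ)
    (𝒯 : Trajectory M₁ M₂ Ω Ξ) : Prop :=
  ∀ᵐ ω ∂μ, ‖𝒯.x 1 ω - 𝒯.x 0 ω‖ ≤ μx / √a ∧ ‖𝒯.y 1 ω - 𝒯.y 0 ω‖ ≤ μy / √a

/-- `P(x_0)` and `J(x_0, y_0)` have finite expectations. -/
def StartIntegrable {M₁ M₂ : ℕ} {Ω Ξ : Type*} [MeasurableSpace Ω] (μ : Measure Ω)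
    (J : Joint M₁ M₂ → ℝ) (𝒯 : Trajectory M₁ M₂ Ω Ξ) : Prop :=
  Integrable (fun ω => envelope J (𝒯.x 1 ω)) μ ∧
    Integrable (fun ω => J (col (𝒯.x 1 ω) (𝒯.y 1 ω))) μ

/-- The standing assumptions on the cost, the stochastic loss and a run of `T` iterations with
`γ = 1`. -/
structure Assumptions {M₁ M₂ : ℕ} {Ω Ξ : Type*} [mΩ : MeasurableSpace Ω] [MeasurableSpace Ξ]
    (J : Joint M₁ M₂ → ℝ) (Q : Joint M₁ M₂ → Ξ → ℝ) (D : Measure Ξ) (μ : Measure Ω)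
    (ℱ : Filtration ℕ mΩ) (ν Lf Lh σ σh a b β μx μy lam : ℝ) (T : ℕ)
    (𝒯 : Trajectory M₁ M₂ Ω Ξ) : Prop where
  lipschitz : LipschitzCost J Lf Lh
  pl : PLCost J ν
  loss : StochasticLoss Q D J σ σh
  run : IsRun Q D μ ℱ β 1 μx μy lam T 𝒯
  scaling : ScalingBounded μ a b lam T 𝒯
  startClose : StartClose μ a μx μy 𝒯
  startIntegrable : StartIntegrable μ J 𝒯

/-- `E P(x_0) - P⋆`. -/
def startEnvelopeGap {M₁ M₂ : ℕ} {Ω Ξ : Type*} [MeasurableSpace Ω] (μ : Measure Ω)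
    (J : Joint M₁ M₂ → ℝ) (𝒯 : Trajectory M₁ M₂ Ω Ξ) : ℝ :=
  ∫ ω, envelope J (𝒯.x 1 ω) ∂μ - envelopeInf J

/-- `E Δ_0 = E[P(x_0) - J(x_0, y_0)]`. -/
def startGap {M₁ M₂ : ℕ} {Ω Ξ : Type*} [MeasurableSpace Ω] (μ : Measure Ω)
    (J : Joint M₁ M₂ → ℝ) (𝒯 : Trajectory M₁ M₂ Ω Ξ) : ℝ :=
  ∫ ω, (envelope J (𝒯.x 1 ω) - J (col (𝒯.x 1 ω) (𝒯.y 1 ω))) ∂μ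

/-- `E ‖y_0 - y^o(x_0)‖`, where `y^o(x_0)` is the maximizer of `J(x_0, ·)` closest to `y_0`. -/
def startDist {M₁ M₂ : ℕ} {Ω Ξ : Type*} [MeasurableSpace Ω] (μ : Measure Ω)
    (J : Joint M₁ M₂ → ℝ) (𝒯 : Trajectory M₁ M₂ Ω Ξ) : ℝ :=
  ∫ ω, Metric.infDist (𝒯.y 1 ω) (maximizers J (𝒯.x 1 ω)) ∂μ

/-- `‖∇ₓJ(x_i, y_i)‖ + ‖∇_yJ(x_i, y_i)‖` at time `i ≥ 0`. -/
def gradNorms {M₁ M₂ : ℕ} {Ω Ξ : Type*} (J : Joint M₁ M₂ → ℝ) (𝒯 : Trajectory M₁ M₂ Ω Ξ) (i : ℕ)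
    (ω : Ω) : ℝ :=
  ‖gradX J (𝒯.x (i + 1) ω) (𝒯.y (i + 1) ω)‖ + ‖gradY J (𝒯.x (i + 1) ω) (𝒯.y (i + 1) ω)‖

/-- `(1/T) ∑_{i<T} E[‖∇ₓJ(x_i, y_i)‖ + ‖∇_yJ(x_i, y_i)‖]`. -/
def avgGradNorm {M₁ M₂ : ℕ} {Ω Ξ : Type*} [MeasurableSpace Ω] (μ : Measure Ω)
    (J : Joint M₁ M₂ → ℝ) (T : ℕ) (𝒯 : Trajectory M₁ M₂ Ω Ξ) : ℝ :=
  (1 / (T : ℝ)) * ∑ i ∈ Finset.range T, ∫ ω, gradNorms J 𝒯 i ω ∂μ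

/-- The random point `(X, Y)` is `ε`-game stationary. -/
def GameStationary {M₁ M₂ : ℕ} {Ω : Type*} [MeasurableSpace Ω] (μ : Measure Ω)
    (J : Joint M₁ M₂ → ℝ) (X : Ω → EuclideanSpace ℝ (Fin M₁))
    (Y : Ω → EuclideanSpace ℝ (Fin M₂)) (ε : ℝ) : Prop :=
  (Integrable (fun ω => ‖gradX J (X ω) (Y ω)‖) μ ∧ ∫ ω, ‖gradX J (X ω) (Y ω)‖ ∂μ ≤ ε) ∧
    (Integrable (fun ω => ‖gradY J (X ω) (Y ω)‖) μ ∧ ∫ ω, ‖gradY J (X ω) (Y ω)‖ ∂μ ≤ ε)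

/-- The output of a run, a pair `(x_τ, y_τ)` with `τ` uniform on `{0, …, T-1}` and independent of
the run, is an `ε`-game stationary point. -/
def OutputStationary {M₁ M₂ : ℕ} {Ω Ξ : Type*} [MeasurableSpace Ω] (μ : Measure Ω)
    (J : Joint M₁ M₂ → ℝ) (T : ℕ) (𝒯 : Trajectory M₁ M₂ Ω Ξ) (ε : ℝ) : Prop :=
  GameStationary (μ.prod (uniformOn (Set.univ : Set (Fin T)))) J
    (fun p => 𝒯.x ((p.2 : ℕ) + 1) p.1) (fun p => 𝒯.y ((p.2 : ℕ) + 1) p.1) ε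

/-- Number of samples drawn in `T` iterations: one per iteration, and one for the initial momenta. -/
def sampleCount (T : ℕ) : ℕ := T + 1

/-- The smoothness constant `L = L_f + L_f κ / 2`. -/
def smoothL (Lf κ : ℝ) : ℝ := Lf + Lf * κ / 2

def C₁ (a b Lf κ : ℝ) : ℝ :=
  5 * √b * Lf / a + 10 * √b * Lf * κ / a + 160 * b * Lf * κ / (a * √a) +
    3 * √b * smoothL Lf κ / (2 * a)

def C₂ (a b Lf κ : ℝ) : ℝ :=
  30 * b * Lf * κ / (a * √a) + 20 * √b * Lf / a

def C₃ (a b κ : ℝ) : ℝ :=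
  160 * κ * b / a + 8 * √b / √a

/-- `β = min{bσ/(aT^{2/3}), a²/(σ²b²T^{2/3}), 1}`. -/
def betaTuned (a b σ : ℝ) (T : ℕ) : ℝ :=
  min (b * σ / (a * (T : ℝ) ^ (2 / 3 : ℝ)))
    (min (a ^ 2 / (σ ^ 2 * b ^ 2 * (T : ℝ) ^ (2 / 3 : ℝ))) 1)

/-- `μ_y = min{bδ/√a, √σ a/(σ_h √b T^{2/3})}`. -/
def muYTuned (a b σ σh δ : ℝ) (T : ℕ) : ℝ :=
  min (b * δ / √a) (√σ * a / (σh * √b * (T : ℝ) ^ (2 / 3 : ℝ)))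

/-- `μ_x = min{√a μ_y/(6√b κ), √b p/T^{2/3}}`. -/
def muXTuned (a b σ σh δ p κ : ℝ) (T : ℕ) : ℝ :=
  min (√a / (6 * √b * κ) * muYTuned a b σ σh δ T) (√b * p / (T : ℝ) ^ (2 / 3 : ℝ))

end

end AdaHMM

open AdaHMM

/-! The argument is a potential descent in which the normalized steps are paid for by the error of
the momentum as an estimate of the gradient.

Geometry. The PL condition yields quadratic growth: `exists_max_near_of_pl` finds a maximizer near
any point by minimizing the square root of the gap plus a distance penalty. With it,
`envelope_sub_le` proves a descent inequality for the envelope P directly, by freezing a nearby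
maximizer, so P is never differentiated. The price is a coupling term proportional to κ times the
x-step times the y-gradient.

Potentials. A scaled normalized step has length at most μ/√a, and its pairing with the true gradient
is at least the gradient norm over √b, minus a multiple of the momentum error
(`le_inner_direction`). Hence P decreases along the x-gradient, up to the coupling, and the gap P -
J decreases along the y-gradient (`gap_step`), because the restriction on μx/μy makes the coupling a
fraction of the y-progress. A weighted sum of the two inequalities telescopes (`combine_steps`,
`sum_grad_norm_le`) and bounds the sum of the gradient norms by the initial gaps, step-size terms
and momentum errors.

Momentum error. The Hessian-vector correction transports the old momentum to the new iterate, so the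
systematic drift is only a second-order Taylor remainder, of size Lh times the squared step
(`momentumError_succ`). What remains is a discounted initial error and two autoregressive sums of
noise, each orthogonal to its past. Orthogonality makes their second moments, not their norms,
accumulate: a noise of variance C gives at most C/β (`arSum_second_moment`). The expected error is
thus at most the discounted σ plus Lh ρ/(2β) + σh √(ρ/β) + σ√β, where ρ bounds the squared
displacement (`integral_norm_momentumError_le`).

Rate. With u = T^{1/3} and β, μy of order u⁻², μx of order at least u⁻²/κ, each of 1/(μT), 1/(βT),
μ/√β and √β is of order 1/u up to powers of κ; the constants grow at most linearly in κ, and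
`explicit_bound_le_rate` collects everything into a multiple of κ/u. Taking u at least a constant
times κ/ε gives the sample complexity. -/

namespace AdaHMM

/-! ### Taylor remainder and quadratic growth under the PL condition. -/

section Calculus

/-- First-order Taylor expansion with quadratic remainder, for a Lipschitz derivative. -/
theorem norm_sub_sub_fderiv_le {E F : Type*} [NormedAddCommGroup E] [NormedSpace ℝ E]
    [NormedAddCommGroup F] [NormedSpace ℝ F] {f : E → F} {f' : E → E →L[ℝ] F} {K : ℝ}
    (hf : ∀ z, HasFDerivAt f (f' z) z) (hK : ∀ z w, ‖f' z - f' w‖ ≤ K * ‖z - w‖) (z w : E) :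
    ‖f w - f z - f' z (w - z)‖ ≤ K / 2 * ‖w - z‖ ^ 2 := by
  set v := w - z with hv
  have hline : ∀ t : ℝ, HasDerivAt (fun t : ℝ => z + t • v) v t := fun t => by
    simpa using ((hasDerivAt_id t).smul_const v).const_add z
  have hg : ∀ t : ℝ, HasDerivAt (fun t : ℝ => f (z + t • v) - f z - t • f' z v)
      (f' (z + t • v) v - f' z v) t := fun t => by
    have h1 := (hf (z + t • v)).comp_hasDerivAt t (hline t)
    have h2 := (hasDerivAt_id t).smul_const (f' z v)
    rw [one_smul] at h2
    exact (h1.sub_const (f z)).sub h2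
  have hB : ∀ t : ℝ, HasDerivAt (fun t : ℝ => K / 2 * ‖v‖ ^ 2 * t ^ 2) (K * ‖v‖ ^ 2 * t) t :=
    fun t => by
      have := (hasDerivAt_pow 2 t).const_mul (K / 2 * ‖v‖ ^ 2)
      rwa [show K * ‖v‖ ^ 2 * t = K / 2 * ‖v‖ ^ 2 * ((2 : ℕ) * t ^ (2 - 1)) by norm_num; ring]
  have key := image_norm_le_of_norm_deriv_right_le_deriv_boundary
    (f := fun t : ℝ => f (z + t • v) - f z - t • f' z v) (a := 0) (b := 1)
    (fun t _ => (hg t).continuousAt.continuousWithinAt)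
    (fun t _ => (hg t).hasDerivWithinAt) (B := fun t : ℝ => K / 2 * ‖v‖ ^ 2 * t ^ 2)
    (by simp) hB
    (fun t ht => by
      have h1 : f' (z + t • v) v - f' z v = (f' (z + t • v) - f' z) v := by simp
      rw [h1]
      calc ‖(f' (z + t • v) - f' z) v‖ ≤ ‖f' (z + t • v) - f' z‖ * ‖v‖ :=
            ContinuousLinearMap.le_opNorm _ _
        _ ≤ K * ‖z + t • v - z‖ * ‖v‖ := by gcongr; exact hK _ _
        _ = K * ‖v‖ ^ 2 * t := by
            rw [add_sub_cancel_left, norm_smul, Real.norm_of_nonneg ht.1]; ring)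
    (Set.right_mem_Icc.2 zero_le_one)
  simpa [hv] using key

/-- Under the Polyak–Łojasiewicz condition some maximizer lies within a distance of each point
controlled by the optimality gap. -/
theorem exists_max_near_of_pl {E : Type*} [NormedAddCommGroup E] [InnerProductSpace ℝ E]
    [FiniteDimensional ℝ E] {f : E → ℝ} {G : E → E} {ν F : ℝ} (hν : 0 < ν)
    (hf : ∀ y, HasGradientAt f (G y) y) (hF : ∀ y, f y ≤ F)
    (hpl : ∀ y, 2 * ν * (F - f y) ≤ ‖G y‖ ^ 2) (y₀ : E) :
    ∃ y, f y = F ∧ ν * ‖y - y₀‖ ^ 2 ≤ 8 * (F - f y₀) := by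
  have hcont : Continuous f := continuous_iff_continuousAt.2 fun y => (hf y).continuousAt
  -- Away from the maximizers PL forces √(F - f) to have slope at least √(ν/2). Any penalty weight
  -- strictly below that slope would do; √(ν/8) is half of it. A minimizer of the penalized function
  -- then cannot have a positive gap.
  set c : ℝ := √(ν / 8) with hc
  have hcpos : 0 < c := Real.sqrt_pos.2 (by positivity)
  have hc2 : c ^ 2 = ν / 8 := Real.sq_sqrt (by positivity)
  set h : E → ℝ := fun y => √(F - f y) + c * ‖y - y₀‖ with hh
  have hhc : Continuous h := by fun_prop
  have htop : Filter.Tendsto h (Filter.cocompact E) Filter.atTop := by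
    have h1 : Filter.Tendsto (fun y => c * (‖y‖ - ‖y₀‖)) (Filter.cocompact E) Filter.atTop :=
      (Filter.tendsto_atTop_add_const_right _ (-‖y₀‖)
        (tendsto_norm_cocompact_atTop (E := E))).const_mul_atTop hcpos
    refine Filter.tendsto_atTop_mono (fun y => ?_) h1
    have h2 := mul_le_mul_of_nonneg_left (norm_sub_norm_le y y₀) hcpos.le
    have h3 := Real.sqrt_nonneg (F - f y)
    simp only [hh]
    linarith
  obtain ⟨y, hy⟩ := hhc.exists_forall_le htop
  refine ⟨y, ?_, ?_⟩
  · by_contra hne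
    have hgap : 0 < F - f y := sub_pos.2 (lt_of_le_of_ne (hF y) hne)
    set s := √(F - f y) with hs
    have hspos : 0 < s := Real.sqrt_pos.2 hgap
    have hs2 : s ^ 2 = F - f y := Real.sq_sqrt hgap.le
    set v := G y with hv
    have hv2 : 2 * ν * s ^ 2 ≤ ‖v‖ ^ 2 := by rw [hs2]; exact hpl y
    have hvpos : 0 < ‖v‖ := by
      rcases (norm_nonneg v).eq_or_lt with h0 | h0
      · rw [← h0] at hv2
        have : 0 < 2 * ν * s ^ 2 := by positivity
        norm_num at hv2
        linarith
      · exact h0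
    have hline : HasDerivAt (fun t : ℝ => y + t • v) v 0 := by
      simpa using ((hasDerivAt_id (0 : ℝ)).smul_const v).const_add y
    -- The penalty is replaced by its linear majorant c‖v‖t along the ray, since the norm itself
    -- need not be differentiable when y = y₀. Minimality of y survives the replacement for t > 0.
    have hφ : HasDerivAt (fun t : ℝ => √(F - f (y + t • v)) + c * ‖v‖ * t)
        (-(‖v‖ ^ 2) / (2 * s) + c * ‖v‖) 0 := by
      have h0 : HasFDerivAt f (InnerProductSpace.toDual ℝ E v) (y + (0 : ℝ) • v) := by
        simpa using (hf y).hasFDerivAt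
      have h1 : HasDerivAt (fun t : ℝ => f (y + t • v)) (‖v‖ ^ 2) 0 := by
        have := h0.comp_hasDerivAt (0 : ℝ) hline
        rw [InnerProductSpace.toDual_apply_apply, real_inner_self_eq_norm_sq] at this
        exact this
      have h2 := (h1.const_sub F).sqrt (by simpa using hgap.ne')
      have h3 := (hasDerivAt_id (0 : ℝ)).const_mul (c * ‖v‖)
      rw [zero_smul, add_zero, ← hs] at h2
      rw [mul_one] at h3
      exact h2.add h3
    have hnn : 0 ≤ -(‖v‖ ^ 2) / (2 * s) + c * ‖v‖ := by
      refine ge_of_tendsto hφ.tendsto_slope_zero_right ?_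
      filter_upwards [self_mem_nhdsWithin] with t ht
      have ht : 0 < t := ht
      have h1 := hy (y + t • v)
      have h2 : ‖y + t • v - y₀‖ ≤ ‖y - y₀‖ + t * ‖v‖ := by
        rw [show y + t • v - y₀ = (y - y₀) + t • v by abel]
        refine (norm_add_le _ _).trans ?_
        rw [norm_smul, Real.norm_of_nonneg ht.le]
      have h3 := mul_le_mul_of_nonneg_left h2 hcpos.le
      simp only [hh] at h1
      simp only [smul_eq_mul, zero_add, zero_smul, add_zero, mul_zero]
      refine mul_nonneg (inv_nonneg.2 ht.le) ?_
      rw [← hs] at h1 ⊢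
      linarith
    have h4 : ‖v‖ ≤ 2 * s * c := by
      rw [neg_div, neg_add_eq_sub, sub_nonneg, div_le_iff₀ (by positivity)] at hnn
      have : ‖v‖ * ‖v‖ ≤ (2 * s * c) * ‖v‖ := by nlinarith
      exact le_of_mul_le_mul_right this hvpos
    have h5 : ‖v‖ ^ 2 ≤ (2 * s * c) ^ 2 := pow_le_pow_left₀ hvpos.le h4 2
    have h6 : (2 * s * c) ^ 2 = ν / 2 * s ^ 2 := by rw [mul_pow, hc2]; ring
    have : 0 < ν * s ^ 2 := by positivity
    linarith
  · have h1 := hy y₀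
    simp only [hh, sub_self, norm_zero, mul_zero, add_zero] at h1
    have h2 : c * ‖y - y₀‖ ≤ √(F - f y₀) := by linarith [Real.sqrt_nonneg (F - f y)]
    have h3 := pow_le_pow_left₀ (by positivity) h2 2
    rw [mul_pow, hc2, Real.sq_sqrt (sub_nonneg.2 (hF y₀))] at h3
    linarith

end Calculus

/-! ### The cost, its partial gradients and its envelope. -/

section Cost

variable {M₁ M₂ : ℕ} {J : Joint M₁ M₂ → ℝ} {ν Lf Lh : ℝ}

theorem norm_fst_le (z : Joint M₁ M₂) : ‖z.fst‖ ≤ ‖z‖ := by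
  have := WithLp.prod_norm_sq_eq_of_L2 z
  exact le_of_sq_le_sq (by nlinarith [sq_nonneg ‖z.snd‖]) (norm_nonneg _)

theorem norm_snd_le (z : Joint M₁ M₂) : ‖z.snd‖ ≤ ‖z‖ := by
  have := WithLp.prod_norm_sq_eq_of_L2 z
  exact le_of_sq_le_sq (by nlinarith [sq_nonneg ‖z.fst‖]) (norm_nonneg _)

theorem norm_col_zero_right (x : EuclideanSpace ℝ (Fin M₁)) :
    ‖(col x 0 : Joint M₁ M₂)‖ = ‖x‖ := by
  simp [col]

theorem norm_col_zero_left (y : EuclideanSpace ℝ (Fin M₂)) :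
    ‖(col 0 y : Joint M₁ M₂)‖ = ‖y‖ := by
  simp [col]

theorem LipschitzCost.hasGradientAt (h : LipschitzCost J Lf Lh) (z : Joint M₁ M₂) :
    HasGradientAt J (gradient J z) z :=
  (h.contDiff.differentiable (by norm_num) z).hasGradientAt

theorem LipschitzCost.hasFDerivAt (h : LipschitzCost J Lf Lh) (z : Joint M₁ M₂) :
    HasFDerivAt J (InnerProductSpace.toDual ℝ _ (gradient J z)) z :=
  (h.hasGradientAt z).hasFDerivAt

theorem LipschitzCost.contDiff_gradient (h : LipschitzCost J Lf Lh) :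
    ContDiff ℝ 1 (gradient J) := by
  have h1 : ContDiff ℝ 1 (fderiv ℝ J) := h.contDiff.fderiv_right (by norm_num)
  exact (InnerProductSpace.toDual ℝ
    (Joint M₁ M₂)).symm.toContinuousLinearEquiv.toContinuousLinearMap.contDiff.comp h1

theorem LipschitzCost.hasFDerivAt_gradient (h : LipschitzCost J Lf Lh) (z : Joint M₁ M₂) :
    HasFDerivAt (gradient J) (hessian J z) z :=
  (h.contDiff_gradient.differentiable (by norm_num) z).hasFDerivAt

theorem LipschitzCost.continuous_hessian (h : LipschitzCost J Lf Lh) :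
    Continuous (hessian J) :=
  h.contDiff_gradient.continuous_fderiv (by norm_num)

theorem LipschitzCost.abs_sub_sub_inner_le (h : LipschitzCost J Lf Lh) (z w : Joint M₁ M₂) :
    |J w - J z - inner ℝ (gradient J z) (w - z)| ≤ Lf / 2 * ‖w - z‖ ^ 2 := by
  have := norm_sub_sub_fderiv_le h.hasFDerivAt (K := Lf) (fun z w => by
    rw [← map_sub, LinearIsometryEquiv.norm_map]; exact h.gradient_lipschitz z w) z w
  simpa [InnerProductSpace.toDual_apply_apply] using this

theorem LipschitzCost.norm_gradient_sub_sub_le (h : LipschitzCost J Lf Lh) (z w : Joint M₁ M₂) :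
    ‖gradient J w - gradient J z - hessian J z (w - z)‖ ≤ Lh / 2 * ‖w - z‖ ^ 2 :=
  norm_sub_sub_fderiv_le h.hasFDerivAt_gradient h.hessian_lipschitz z w

theorem inner_gradient (z : Joint M₁ M₂) (w : Joint M₁ M₂) :
    inner ℝ (gradient J z) w =
      inner ℝ (gradX J z.fst z.snd) w.fst + inner ℝ (gradY J z.fst z.snd) w.snd := by
  rw [WithLp.prod_inner_apply]; rfl

theorem PLCost.envelope_eq (x : EuclideanSpace ℝ (Fin M₁))
    {y : EuclideanSpace ℝ (Fin M₂)} (hy : y ∈ maximizers J x) : envelope J x = J (col x y) :=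
  le_antisymm (ciSup_le hy)
    (le_ciSup (f := fun y => J (col x y)) ⟨_, by rintro _ ⟨y', rfl⟩; exact hy y'⟩ y)

theorem PLCost.le_envelope (h : PLCost J ν) (x : EuclideanSpace ℝ (Fin M₁))
    (y : EuclideanSpace ℝ (Fin M₂)) : J (col x y) ≤ envelope J x := by
  obtain ⟨y', hy'⟩ := h.exists_max x
  rw [envelope_eq x hy']
  exact hy' y

theorem LipschitzCost.hasGradientAt_snd (h : LipschitzCost J Lf Lh)
    (x : EuclideanSpace ℝ (Fin M₁)) (y : EuclideanSpace ℝ (Fin M₂)) :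
    HasGradientAt (fun y => J (col x y)) (gradY J x y) y := by
  rw [hasGradientAt_iff_hasFDerivAt]
  have h1 : HasFDerivAt (fun y : EuclideanSpace ℝ (Fin M₂) => (col x y : Joint M₁ M₂))
      ((WithLp.prodContinuousLinearEquiv 2 ℝ (EuclideanSpace ℝ (Fin M₁))
        (EuclideanSpace ℝ (Fin M₂))).symm.toContinuousLinearMap.comp
          (ContinuousLinearMap.inr ℝ _ _)) y :=
    (WithLp.prodContinuousLinearEquiv 2 ℝ (EuclideanSpace ℝ (Fin M₁))
      (EuclideanSpace ℝ (Fin M₂))).symm.toContinuousLinearMap.hasFDerivAt.comp y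
        (hasFDerivAt_prodMk_right x y)
  have h2 := (h.hasFDerivAt (col x y)).comp y h1
  refine h2.congr_fderiv ?_
  ext v
  change inner ℝ (gradient J (col x y)) (col 0 v) = inner ℝ (gradY J x y) v
  rw [inner_gradient]
  simp

/-- Quadratic growth applied to the slice J(x, ·), with the envelope value as the upper bound. -/
theorem exists_maximizer_near (hL : LipschitzCost J Lf Lh) (hP : PLCost J ν) (hν : 0 < ν)
    (x : EuclideanSpace ℝ (Fin M₁)) (y : EuclideanSpace ℝ (Fin M₂)) :
    ∃ y' ∈ maximizers J x, ν * ‖y' - y‖ ^ 2 ≤ 8 * (envelope J x - J (col x y)) := by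
  obtain ⟨y', hy', hd⟩ := exists_max_near_of_pl hν (hL.hasGradientAt_snd x)
    (hP.le_envelope x) (hP.pl x) y
  exact ⟨y', fun y'' => hy' ▸ hP.le_envelope x y'', hd⟩

theorem norm_gradX_sub_le (hL : LipschitzCost J Lf Lh) (x : EuclideanSpace ℝ (Fin M₁))
    (y y' : EuclideanSpace ℝ (Fin M₂)) :
    ‖gradX J x y' - gradX J x y‖ ≤ Lf * ‖y' - y‖ := by
  have h := hL.gradient_lipschitz (col x y') (col x y)
  have h2 : (col x y' - col x y : Joint M₁ M₂) = col 0 (y' - y) := by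
    rw [← WithLp.toLp_sub]; simp
  rw [h2, norm_col_zero_left] at h
  exact (norm_fst_le (gradient J (col x y') - gradient J (col x y))).trans h

theorem norm_gradY_sub_le (hL : LipschitzCost J Lf Lh) (x x' : EuclideanSpace ℝ (Fin M₁))
    (y : EuclideanSpace ℝ (Fin M₂)) :
    ‖gradY J x' y - gradY J x y‖ ≤ Lf * ‖x' - x‖ := by
  have h := hL.gradient_lipschitz (col x' y) (col x y)
  have h2 : (col x' y - col x y : Joint M₁ M₂) = col (x' - x) 0 := by
    rw [← WithLp.toLp_sub]; simp
  rw [h2, norm_col_zero_right] at h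
  exact (norm_snd_le (gradient J (col x' y) - gradient J (col x y))).trans h

/-- Descent inequality for the envelope, along the partial gradient at an arbitrary `y`. -/
theorem envelope_sub_le (hL : LipschitzCost J Lf Lh) (hP : PLCost J ν) (hν : 0 < ν)
    (hνL : ν ≤ Lf) (x x' : EuclideanSpace ℝ (Fin M₁)) (y : EuclideanSpace ℝ (Fin M₂)) :
    envelope J x' - envelope J x ≤ inner ℝ (gradX J x y) (x' - x)
      + 2 * (Lf / ν) * ‖x' - x‖ * ‖gradY J x y‖
      + Lf * (1 / 2 + 2 * (Lf / ν)) * ‖x' - x‖ ^ 2 := by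
  have hLf : 0 < Lf := hν.trans_le hνL
  obtain ⟨y', hy', hd⟩ := exists_maximizer_near hL hP hν x' y
  -- Quadratic growth and PL, both at x', give ν²‖y' - y‖² ≤ 8ν·gap ≤ 4‖∇_y J(x', y)‖². The gradient
  -- is then moved from x' back to x by smoothness.
  have hdist : ‖y' - y‖ ≤ 2 / ν * (‖gradY J x y‖ + Lf * ‖x' - x‖) := by
    have h1 : ν * ‖y' - y‖ ≤ 2 * ‖gradY J x' y‖ := by
      refine le_of_sq_le_sq ?_ (by positivity)
      have := hP.pl x' y
      nlinarith
    have h2 : ‖gradY J x' y‖ ≤ ‖gradY J x y‖ + Lf * ‖x' - x‖ := by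
      have := norm_gradY_sub_le hL x x' y
      have := norm_sub_norm_le (gradY J x' y) (gradY J x y)
      linarith
    rw [div_mul_eq_mul_div, le_div_iff₀ hν]
    linarith
  have hexp : J (col x' y') - J (col x y') ≤ inner ℝ (gradX J x y') (x' - x)
      + Lf / 2 * ‖x' - x‖ ^ 2 := by
    have h := (abs_le.1 (hL.abs_sub_sub_inner_le (col x y') (col x' y'))).2
    have h2 : (col x' y' - col x y' : Joint M₁ M₂) = col (x' - x) 0 := by
      rw [← WithLp.toLp_sub]; simp
    rw [h2, norm_col_zero_right, inner_gradient] at h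
    simp only [WithLp.toLp_fst, WithLp.toLp_snd, inner_zero_right, add_zero] at h
    linarith
  have hin : inner ℝ (gradX J x y') (x' - x) ≤ inner ℝ (gradX J x y) (x' - x)
      + Lf * ‖y' - y‖ * ‖x' - x‖ := by
    have h1 : inner ℝ (gradX J x y') (x' - x) = inner ℝ (gradX J x y) (x' - x)
        + inner ℝ (gradX J x y' - gradX J x y) (x' - x) := by rw [inner_sub_left]; ring
    have h2 := real_inner_le_norm (gradX J x y' - gradX J x y) (x' - x)
    have h3 := mul_le_mul_of_nonneg_right (norm_gradX_sub_le hL x y y') (norm_nonneg (x' - x))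
    linarith
  -- Freezing y' bounds the difference of envelopes by J(x', y') - J(x, y'): y' is optimal at x' and
  -- merely admissible at x.
  have hmax := PLCost.envelope_eq x' hy'
  have hle := hP.le_envelope x y'
  have h4 : Lf * ‖y' - y‖ * ‖x' - x‖
      ≤ Lf * (2 / ν * (‖gradY J x y‖ + Lf * ‖x' - x‖)) * ‖x' - x‖ := by gcongr
  have h5 : Lf * (2 / ν * (‖gradY J x y‖ + Lf * ‖x' - x‖)) * ‖x' - x‖
      = 2 * (Lf / ν) * ‖x' - x‖ * ‖gradY J x y‖ + Lf * (2 * (Lf / ν)) * ‖x' - x‖ ^ 2 := by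
    ring
  linarith

theorem PLCost.envelopeInf_le (hP : PLCost J ν) (x : EuclideanSpace ℝ (Fin M₁)) :
    envelopeInf J ≤ envelope J x :=
  ciInf_le hP.bddBelow x

end Cost

/-! ### The scaled, normalized update direction. -/

section Direction

variable {n : ℕ} {a b : ℝ} {d : Fin n → ℝ}

theorem DiagBetween.bounds (h : DiagBetween a b d) (j : Fin n) : a ≤ d j ∧ d j ≤ b := by
  have h1 := h.1.diag_nonneg (i := j)
  have h2 := h.2.diag_nonneg (i := j)
  simp at h1 h2
  exact ⟨h1, h2⟩

theorem norm_diagPowMul_sq (p : ℝ) (m : EuclideanSpace ℝ (Fin n)) :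
    ‖diagPowMul d p m‖ ^ 2 = ∑ j, (d j ^ p * m j) ^ 2 := by
  simp only [EuclideanSpace.norm_sq_eq, diagPowMul, Real.norm_eq_abs, sq_abs]

theorem rpow_neg_half_sq {t : ℝ} (ht : 0 < t) : (t ^ (-1 / 2 : ℝ)) ^ 2 = t⁻¹ := by
  rw [← Real.rpow_natCast, ← Real.rpow_mul ht.le]
  norm_num [Real.rpow_neg_one]

theorem inner_diagPowMul (ha : 0 < a) (h : DiagBetween a b d) (m : EuclideanSpace ℝ (Fin n)) :
    inner ℝ m (diagPowMul d (-1) m) = ‖diagPowMul d (-1 / 2) m‖ ^ 2 := by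
  rw [norm_diagPowMul_sq, PiLp.inner_apply]
  refine Finset.sum_congr rfl fun j _ => ?_
  have hd : 0 < d j := ha.trans_le (h.bounds j).1
  rw [mul_pow, rpow_neg_half_sq hd]
  simp [diagPowMul, Real.rpow_neg_one]
  ring

theorem norm_diagPowMul_neg_one_le (ha : 0 < a) (h : DiagBetween a b d)
    (m : EuclideanSpace ℝ (Fin n)) :
    ‖diagPowMul d (-1) m‖ ≤ ‖diagPowMul d (-1 / 2) m‖ / √a := by
  refine le_of_sq_le_sq ?_ (by positivity)
  rw [div_pow, Real.sq_sqrt ha.le, norm_diagPowMul_sq, norm_diagPowMul_sq, Finset.sum_div]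
  refine Finset.sum_le_sum fun j _ => ?_
  have hd : 0 < d j := ha.trans_le (h.bounds j).1
  rw [mul_pow, mul_pow, rpow_neg_half_sq hd, Real.rpow_neg_one, mul_div_right_comm]
  refine mul_le_mul_of_nonneg_right ?_ (sq_nonneg _)
  rw [sq, div_eq_mul_inv]
  exact mul_le_mul_of_nonneg_left (inv_anti₀ ha (h.bounds j).1) (inv_nonneg.2 hd.le)

theorem norm_div_le_norm_diagPowMul (ha : 0 < a) (h : DiagBetween a b d) (hab : a ≤ b)
    (m : EuclideanSpace ℝ (Fin n)) :
    ‖m‖ / √b ≤ ‖diagPowMul d (-1 / 2) m‖ := by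
  have hb : 0 < b := ha.trans_le hab
  refine le_of_sq_le_sq ?_ (by positivity)
  rw [div_pow, Real.sq_sqrt hb.le, norm_diagPowMul_sq, EuclideanSpace.norm_sq_eq, Finset.sum_div]
  refine Finset.sum_le_sum fun j _ => ?_
  have hd : 0 < d j := ha.trans_le (h.bounds j).1
  rw [mul_pow, rpow_neg_half_sq hd, Real.norm_eq_abs, sq_abs, div_eq_inv_mul]
  exact mul_le_mul_of_nonneg_right (inv_anti₀ hd (h.bounds j).2) (sq_nonneg _)

/-- Normalization by ‖N^{-1/2}m‖ removes the size of m, and the remaining factor N^{-1/2} costs at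
most 1/√a. Displacements are therefore bounded whatever the momentum does. -/
theorem norm_direction_le (ha : 0 < a) (h : DiagBetween a b d) (m : EuclideanSpace ℝ (Fin n)) :
    ‖direction d m‖ ≤ 1 / √a := by
  rw [direction, norm_smul, norm_inv, norm_norm, inv_mul_eq_div]
  refine div_le_of_le_mul₀ (norm_nonneg _) (by positivity) ?_
  have := norm_diagPowMul_neg_one_le ha h m
  rwa [one_div_mul_eq_div]

/-- The pairing of m with N⁻¹m is ‖N^{-1/2}m‖², so after normalization exactly ‖N^{-1/2}m‖ is left.
-/
theorem le_inner_direction_self (ha : 0 < a) (hab : a ≤ b) (h : DiagBetween a b d)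
    (m : EuclideanSpace ℝ (Fin n)) :
    ‖m‖ / √b ≤ inner ℝ m (direction d m) := by
  rw [direction, inner_smul_right, inner_diagPowMul ha h]
  refine (norm_div_le_norm_diagPowMul ha h hab m).trans_eq ?_
  rcases eq_or_ne ‖diagPowMul d (-1 / 2) m‖ 0 with h0 | h0
  · simp [h0]
  · field_simp

/-- The update direction built from an approximation `m` of `g` is aligned with `g`, up to the
approximation error. -/
theorem le_inner_direction (ha : 0 < a) (hab : a ≤ b) (h : DiagBetween a b d)
    (m g : EuclideanSpace ℝ (Fin n)) :
    ‖g‖ / √b - 2 * ‖m - g‖ / √a ≤ inner ℝ g (direction d m) := by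
  have h1 := le_inner_direction_self ha hab h m
  have h2 := norm_direction_le ha h m
  have h3 : inner ℝ g (direction d m) = inner ℝ m (direction d m)
      - inner ℝ (m - g) (direction d m) := by rw [inner_sub_left]; ring
  have h4 : inner ℝ (m - g) (direction d m) ≤ ‖m - g‖ / √a := by
    refine (real_inner_le_norm _ _).trans ?_
    rw [div_eq_mul_one_div]
    exact mul_le_mul_of_nonneg_left h2 (norm_nonneg _)
  -- This is the second copy of the error, from replacing ‖m‖ by ‖g‖; the first, `h4`, comes from
  -- replacing m by g in the pairing. Together they give the factor 2.
  have h5 : ‖g‖ / √b ≤ ‖m‖ / √b + ‖m - g‖ / √a := by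
    have h6 : ‖g‖ ≤ ‖m‖ + ‖m - g‖ := by
      have := norm_sub_norm_le g m
      rw [norm_sub_rev] at this
      linarith
    have h7 : ‖m - g‖ / √b ≤ ‖m - g‖ / √a :=
      div_le_div_of_nonneg_left (norm_nonneg _) (Real.sqrt_pos.2 ha) (Real.sqrt_le_sqrt hab)
    have h8 := div_le_div_of_nonneg_right h6 (Real.sqrt_nonneg b)
    rw [add_div] at h8
    linarith
  have h9 : 2 * ‖m - g‖ / √a = ‖m - g‖ / √a + ‖m - g‖ / √a := by ring
  linarith

end Direction

/-! ### Pathwise descent of the two potentials. -/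

section Path

variable {M₁ M₂ : ℕ} {J : Joint M₁ M₂ → ℝ} {ν Lf Lh a b μx μy : ℝ}

/-- One step of the algorithm decreases the envelope, up to the momentum error and the partial
gradient in `y`. -/
theorem envelope_step (hL : LipschitzCost J Lf Lh) (hP : PLCost J ν) (hν : 0 < ν) (hνL : ν ≤ Lf)
    (ha : 0 < a) (hμx : 0 < μx) {d : Fin M₁ → ℝ} (hd : DiagBetween a b d)
    (x : EuclideanSpace ℝ (Fin M₁)) (y : EuclideanSpace ℝ (Fin M₂))
    (m : EuclideanSpace ℝ (Fin M₁)) :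
    envelope J (x - μx • direction d m) - envelope J x ≤
      -(μx * inner ℝ (gradX J x y) (direction d m))
      + 2 * (Lf / ν) * (μx / √a) * ‖gradY J x y‖ + Lf * (1 / 2 + 2 * (Lf / ν)) * (μx ^ 2 / a) := by
  have hLf : 0 < Lf := hν.trans_le hνL
  have h := envelope_sub_le hL hP hν hνL x (x - μx • direction d m) y
  have hn : ‖x - μx • direction d m - x‖ ≤ μx / √a := by
    rw [sub_sub_cancel_left, norm_neg, norm_smul, Real.norm_of_nonneg hμx.le, div_eq_mul_one_div]
    exact mul_le_mul_of_nonneg_left (norm_direction_le ha hd m) hμx.le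
  have hn2 : ‖x - μx • direction d m - x‖ ^ 2 ≤ μx ^ 2 / a := by
    refine (pow_le_pow_left₀ (norm_nonneg _) hn 2).trans_eq ?_
    rw [div_pow, Real.sq_sqrt ha.le]
  have hin : inner ℝ (gradX J x y) (x - μx • direction d m - x)
      = -(μx * inner ℝ (gradX J x y) (direction d m)) := by
    rw [sub_sub_cancel_left, inner_neg_right, inner_smul_right]
  rw [hin] at h
  refine h.trans ?_
  gcongr

/-- One step of the algorithm decreases the gap `P(x) - J(x, y)`, up to the momentum error. -/
theorem gap_step (hL : LipschitzCost J Lf Lh) (hP : PLCost J ν) (hν : 0 < ν) (hνL : ν ≤ Lf)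
    (ha : 0 < a) (hab : a ≤ b) (hμx : 0 < μx) (hμy : 0 < μy)
    (hμ : μx ≤ √a * μy / (6 * √b * (Lf / ν)))
    {dx : Fin M₁ → ℝ} {dy : Fin M₂ → ℝ} (hdx : DiagBetween a b dx) (hdy : DiagBetween a b dy)
    (x mx : EuclideanSpace ℝ (Fin M₁)) (y my : EuclideanSpace ℝ (Fin M₂)) :
    (envelope J (x - μx • direction dx mx)
        - J (col (x - μx • direction dx mx) (y + μy • direction dy my)))
      - (envelope J x - J (col x y)) ≤
      -(2 / 3 * (μy / √b) * ‖gradY J x y‖) + 2 * μy * ‖my - gradY J x y‖ / √a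
      + Lf * (1 + 2 * (Lf / ν)) * (μx ^ 2 / a) + Lf / 2 * (μy ^ 2 / a) := by
  have hLf : 0 < Lf := hν.trans_le hνL
  have hb : 0 < b := ha.trans_le hab
  have h1 := envelope_step hL hP hν hνL ha hμx hdx x y mx
  have h2 := (abs_le.1 (hL.abs_sub_sub_inner_le (col x y)
    (col (x - μx • direction dx mx) (y + μy • direction dy my)))).1
  have hdiff : (col (x - μx • direction dx mx) (y + μy • direction dy my) - col x y : Joint M₁ M₂)
      = col (-(μx • direction dx mx)) (μy • direction dy my) := by
    rw [← WithLp.toLp_sub]; simp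
  rw [hdiff, inner_gradient, WithLp.prod_norm_sq_eq_of_L2] at h2
  simp only [WithLp.toLp_fst, WithLp.toLp_snd, inner_neg_right, inner_smul_right, norm_neg] at h2
  have hx2 : ‖μx • direction dx mx‖ ^ 2 ≤ μx ^ 2 / a := by
    rw [norm_smul, mul_pow, Real.norm_of_nonneg hμx.le, div_eq_mul_one_div]
    refine mul_le_mul_of_nonneg_left ?_ (sq_nonneg _)
    refine (pow_le_pow_left₀ (norm_nonneg _) (norm_direction_le ha hdx mx) 2).trans_eq ?_
    rw [div_pow, Real.sq_sqrt ha.le, one_pow]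
  have hy2 : ‖μy • direction dy my‖ ^ 2 ≤ μy ^ 2 / a := by
    rw [norm_smul, mul_pow, Real.norm_of_nonneg hμy.le, div_eq_mul_one_div]
    refine mul_le_mul_of_nonneg_left ?_ (sq_nonneg _)
    refine (pow_le_pow_left₀ (norm_nonneg _) (norm_direction_le ha hdy my) 2).trans_eq ?_
    rw [div_pow, Real.sq_sqrt ha.le, one_pow]
  have h3 := mul_le_mul_of_nonneg_left (le_inner_direction ha hab hdy my (gradY J x y)) hμy.le
  have h4 : Lf / 2 * (‖μx • direction dx mx‖ ^ 2 + ‖μy • direction dy my‖ ^ 2)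
      ≤ Lf / 2 * (μx ^ 2 / a + μy ^ 2 / a) := by gcongr
  -- The ratio of step sizes is chosen for this: the motion of the envelope caused by the x-step
  -- consumes at most a third of the progress made in y.
  have h5 : 2 * (Lf / ν) * (μx / √a) * ‖gradY J x y‖ ≤ 1 / 3 * (μy / √b) * ‖gradY J x y‖ := by
    refine mul_le_mul_of_nonneg_right ?_ (norm_nonneg _)
    have hsa := Real.sqrt_pos.2 ha
    have hsb := Real.sqrt_pos.2 hb
    have hκ : 0 < Lf / ν := by positivity
    rw [le_div_iff₀ (by positivity)] at hμ
    generalize Lf / ν = κ at hμ hκ ⊢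
    rw [← mul_div_assoc, ← mul_div_assoc, div_le_div_iff₀ hsa hsb]
    linarith
  have h6 : μy * (‖gradY J x y‖ / √b - 2 * ‖my - gradY J x y‖ / √a)
      = μy / √b * ‖gradY J x y‖ - 2 * μy * ‖my - gradY J x y‖ / √a := by ring
  -- The pairing of the x-gradient with the x-step has opposite signs in `h1` and `h2` and cancels;
  -- in y the coefficient 1 - 1/3 = 2/3 remains.
  nlinarith

/-- The arithmetic that combines the two one-step inequalities. -/
theorem combine_steps {sa sb κ gx gy e P P' Δ Δ' : ℝ} (hsa : 0 < sa) (hsab : sa ≤ sb)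
    (hμx : 0 < μx) (hμy : 0 < μy) (hκ : 1 ≤ κ) (hLf : 0 < Lf) (he : 0 ≤ e)
    (hμ : μx * (6 * sb * κ) ≤ sa * μy)
    (h1 : P' - P ≤ -(μx * (gx / sb - 2 * e / sa)) + 2 * κ * (μx / sa) * gy
      + Lf * (1 / 2 + 2 * κ) * (μx ^ 2 / sa ^ 2))
    (h2 : Δ' - Δ ≤ -(2 / 3 * (μy / sb) * gy) + 2 * μy * e / sa
      + Lf * (1 + 2 * κ) * (μx ^ 2 / sa ^ 2) + Lf / 2 * (μy ^ 2 / sa ^ 2)) :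
    gx + gy ≤ sb / μx * (P - P') + (1 + 2 * κ * (sb / sa)) * (3 / 2 * (sb / μy)) * (Δ - Δ')
      + (2 * (sb / sa) + 9 * κ * (sb ^ 2 / sa ^ 2)) * e
      + (sb * Lf * (1 / 2 + 2 * κ) / sa ^ 2 * μx
        + 9 / 4 * (κ * sb ^ 2 * Lf / sa ^ 3) * (μx + μy)) := by
  have hsb : 0 < sb := hsa.trans_le hsab
  set r := sb / sa with hr
  have hr1 : 1 ≤ r := (one_le_div hsa).2 hsab
  have hx : gx ≤ sb / μx * (P - P') + 2 * r * e + 2 * κ * r * gy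
      + sb * Lf * (1 / 2 + 2 * κ) / sa ^ 2 * μx := by
    have h := mul_le_mul_of_nonneg_left h1 (div_pos hsb hμx).le
    have e1 : sb / μx * (-(μx * (gx / sb - 2 * e / sa)) + 2 * κ * (μx / sa) * gy
      + Lf * (1 / 2 + 2 * κ) * (μx ^ 2 / sa ^ 2))
      = -gx + 2 * r * e + 2 * κ * r * gy + sb * Lf * (1 / 2 + 2 * κ) / sa ^ 2 * μx := by
      rw [hr]; field_simp; ring
    rw [e1] at h
    linarith
  -- From 6κμx ≤ μy and 1 + 2κ ≤ 3κ: the quadratic x-term, divided by μy, becomes linear in μx with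
  -- no factor κ.
  have hq : (1 + 2 * κ) * μx ^ 2 / μy ≤ μx / 2 := by
    rw [div_le_iff₀ hμy]
    have h3 : 6 * κ * μx ≤ μy := by
      have h4 : sa * (6 * κ * μx) ≤ sb * (6 * κ * μx) := by gcongr
      have h5 : sa * (6 * κ * μx) ≤ sa * μy := by linarith
      exact le_of_mul_le_mul_left h5 hsa
    nlinarith
  have hy : gy ≤ 3 / 2 * (sb / μy) * (Δ - Δ') + 3 * r * e
      + 3 / 4 * (sb * Lf / sa ^ 2) * (μx + μy) := by
    have h := mul_le_mul_of_nonneg_left h2 (by positivity : 0 ≤ 3 / 2 * (sb / μy))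
    have e1 : 3 / 2 * (sb / μy) * (-(2 / 3 * (μy / sb) * gy) + 2 * μy * e / sa
      + Lf * (1 + 2 * κ) * (μx ^ 2 / sa ^ 2) + Lf / 2 * (μy ^ 2 / sa ^ 2))
      = -gy + 3 * r * e + 3 / 2 * (sb * Lf / sa ^ 2) * ((1 + 2 * κ) * μx ^ 2 / μy)
        + 3 / 4 * (sb * Lf / sa ^ 2) * μy := by
      rw [hr]; field_simp; ring
    have h3 := mul_le_mul_of_nonneg_left hq (by positivity : 0 ≤ 3 / 2 * (sb * Lf / sa ^ 2))
    rw [e1] at h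
    linarith
  have hW : 1 + 2 * κ * r ≤ 3 * κ * r := by nlinarith
  have hWnn : 0 ≤ 1 + 2 * κ * r := by positivity
  -- The weight is 1 for gy itself plus 2κr to absorb the coupling in `hx`. It stays exact on Δ -
  -- Δ', whose sign is unknown, and is enlarged to 3κr only on the nonnegative remainder.
  have h4 := mul_le_mul_of_nonneg_left hy hWnn
  have h5 := mul_le_mul_of_nonneg_right hW
    (by positivity : 0 ≤ 3 * r * e + 3 / 4 * (sb * Lf / sa ^ 2) * (μx + μy))
  have e2 : 3 * κ * r * (3 * r * e + 3 / 4 * (sb * Lf / sa ^ 2) * (μx + μy))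
      = 9 * κ * (sb ^ 2 / sa ^ 2) * e + 9 / 4 * (κ * sb ^ 2 * Lf / sa ^ 3) * (μx + μy) := by
    rw [hr]; field_simp; ring
  linarith

/-- Pathwise bound on the sum of the gradient norms along a run, by the initial gaps and the
momentum errors. -/
theorem sum_grad_norm_le (hL : LipschitzCost J Lf Lh) (hP : PLCost J ν) (hν : 0 < ν)
    (hνL : ν ≤ Lf) (ha : 0 < a) (hab : a ≤ b) (hμx : 0 < μx) (hμy : 0 < μy)
    (hμ : μx ≤ √a * μy / (6 * √b * (Lf / ν))) {T : ℕ}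
    {dx : ℕ → Fin M₁ → ℝ} {dy : ℕ → Fin M₂ → ℝ}
    {x mx : ℕ → EuclideanSpace ℝ (Fin M₁)} {y my : ℕ → EuclideanSpace ℝ (Fin M₂)}
    (hd : ∀ i < T, DiagBetween a b (dx i) ∧ DiagBetween a b (dy i))
    (hx : ∀ i < T, x (i + 1) = x i - μx • direction (dx i) (mx i))
    (hy : ∀ i < T, y (i + 1) = y i + μy • direction (dy i) (my i)) :
    ∑ i ∈ Finset.range T, (‖gradX J (x i) (y i)‖ + ‖gradY J (x i) (y i)‖) ≤
      √b / μx * (envelope J (x 0) - envelopeInf J)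
      + 9 / 2 * (Lf / ν * b / (√a * μy)) * (envelope J (x 0) - J (col (x 0) (y 0)))
      + (2 * (√b / √a) + 9 * (Lf / ν) * (b / a))
        * ∑ i ∈ Finset.range T, ‖col (mx i) (my i) - gradient J (col (x i) (y i))‖
      + T * (√b * Lf * (1 / 2 + 2 * (Lf / ν)) / a * μx
        + 9 / 4 * (Lf / ν * b * Lf / (a * √a)) * (μx + μy)) := by
  have hb : 0 < b := ha.trans_le hab
  have hsa := Real.sqrt_pos.2 ha
  have hsb := Real.sqrt_pos.2 hb
  have hsab := Real.sqrt_le_sqrt hab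
  have hLf : 0 < Lf := hν.trans_le hνL
  have hκ : 1 ≤ Lf / ν := (one_le_div hν).2 hνL
  have hsa2 : √a ^ 2 = a := Real.sq_sqrt ha.le
  have hsb2 : √b ^ 2 = b := Real.sq_sqrt hb.le
  have hsa3 : √a ^ 3 = a * √a := by rw [pow_succ, hsa2]
  set Δ : ℕ → ℝ := fun i => envelope J (x i) - J (col (x i) (y i)) with hΔ
  have hstep : ∀ i ∈ Finset.range T, ‖gradX J (x i) (y i)‖ + ‖gradY J (x i) (y i)‖ ≤
      √b / μx * (envelope J (x i) - envelope J (x (i + 1)))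
      + (1 + 2 * (Lf / ν) * (√b / √a)) * (3 / 2 * (√b / μy)) * (Δ i - Δ (i + 1))
      + (2 * (√b / √a) + 9 * (Lf / ν) * (b / a))
        * ‖col (mx i) (my i) - gradient J (col (x i) (y i))‖
      + (√b * Lf * (1 / 2 + 2 * (Lf / ν)) / a * μx
        + 9 / 4 * (Lf / ν * b * Lf / (a * √a)) * (μx + μy)) := by
    intro i hi
    have hi := Finset.mem_range.1 hi
    obtain ⟨hdx, hdy⟩ := hd i hi
    have ex : ‖mx i - gradX J (x i) (y i)‖
        ≤ ‖col (mx i) (my i) - gradient J (col (x i) (y i))‖ :=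
      norm_fst_le (col (mx i) (my i) - gradient J (col (x i) (y i)))
    have ey : ‖my i - gradY J (x i) (y i)‖
        ≤ ‖col (mx i) (my i) - gradient J (col (x i) (y i))‖ :=
      norm_snd_le (col (mx i) (my i) - gradient J (col (x i) (y i)))
    rw [le_div_iff₀ (by positivity)] at hμ
    have h := combine_steps (κ := Lf / ν) (Lf := Lf) hsa hsab hμx hμy hκ hLf
      (norm_nonneg (col (mx i) (my i) - gradient J (col (x i) (y i)))) hμ
      (gx := ‖gradX J (x i) (y i)‖) (gy := ‖gradY J (x i) (y i)‖) (P := envelope J (x i))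
      (P' := envelope J (x (i + 1))) (Δ := Δ i) (Δ' := Δ (i + 1)) ?_ ?_
    · rwa [hsa2, hsb2, hsa3] at h
    · rw [hsa2, hx i hi]
      refine (envelope_step hL hP hν hνL ha hμx hdx (x i) (y i) (mx i)).trans ?_
      have h2 := le_inner_direction ha hab hdx (mx i) (gradX J (x i) (y i))
      gcongr
      refine le_trans ?_ h2
      gcongr
    · rw [hsa2]
      simp only [hΔ]
      rw [hx i hi, hy i hi]
      refine (gap_step hL hP hν hνL ha hab hμx hμy ?_ hdx hdy (x i) (mx i) (y i) (my i)).trans ?_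
      · rwa [le_div_iff₀ (by positivity)]
      · gcongr
  refine (Finset.sum_le_sum hstep).trans ?_
  rw [Finset.sum_add_distrib, Finset.sum_add_distrib, Finset.sum_add_distrib, ← Finset.mul_sum,
    ← Finset.mul_sum, ← Finset.mul_sum, Finset.sum_range_sub', Finset.sum_range_sub',
    Finset.sum_const, Finset.card_range, nsmul_eq_mul]
  have hP0 := hP.envelopeInf_le (x T)
  have hΔT : 0 ≤ Δ T := sub_nonneg.2 (hP.le_envelope _ _)
  have hΔ0 : 0 ≤ Δ 0 := sub_nonneg.2 (hP.le_envelope _ _)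
  have hr1 : 1 ≤ √b / √a := (one_le_div hsa).2 hsab
  have hW : 1 + 2 * (Lf / ν) * (√b / √a) ≤ 3 * (Lf / ν) * (√b / √a) := by nlinarith
  have hcoef : 3 * (Lf / ν) * (√b / √a) * (3 / 2 * (√b / μy))
      = 9 / 2 * (Lf / ν * b / (√a * μy)) := by
    rw [← hsb2, Real.sqrt_sq hsb.le]; field_simp; ring
  -- After telescoping the final gap can be dropped, and only then may the weight be enlarged, since
  -- it now multiplies Δ 0 ≥ 0.
  have hgap : (1 + 2 * (Lf / ν) * (√b / √a)) * (3 / 2 * (√b / μy)) * (Δ 0 - Δ T)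
      ≤ 9 / 2 * (Lf / ν * b / (√a * μy)) * Δ 0 := by
    rw [← hcoef]
    calc _ ≤ (1 + 2 * (Lf / ν) * (√b / √a)) * (3 / 2 * (√b / μy)) * Δ 0 :=
          mul_le_mul_of_nonneg_left (by linarith) (by positivity)
      _ ≤ _ := by gcongr
  have henv : √b / μx * (envelope J (x 0) - envelope J (x T))
      ≤ √b / μx * (envelope J (x 0) - envelopeInf J) := by gcongr
  linarith

end Path

/-! ### Fresh samples, centered noise and autoregressive sums. -/

section Noise

variable {Ω Ξ 𝒵 E : Type*} {m : MeasurableSpace Ω} [mΩ : MeasurableSpace Ω] [mΞ : MeasurableSpace Ξ] [MeasurableSpace 𝒵]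
  {μ : Measure Ω} [IsProbabilityMeasure μ] {D : Measure Ξ} [IsProbabilityMeasure D]
  {ξ : Ω → Ξ} {Z : Ω → 𝒵}

/-- A sample that is independent of the past may be replaced by a fresh coordinate. -/
theorem identDistrib_fresh_sample (hm : m ≤ mΩ) (hZ : Measurable[m] Z) (hξ : Measurable ξ)
    (hlaw : μ.map ξ = D) (hind : Indep (mΞ.comap ξ) m μ) :
    IdentDistrib (fun ω => (Z ω, ξ ω)) (fun p : Ω × Ξ => (Z p.1, p.2)) μ (μ.prod D) := by
  have hZ' : Measurable Z := hZ.mono hm le_rfl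
  refine ⟨(hZ'.prodMk hξ).aemeasurable,
    ((hZ'.comp measurable_fst).prodMk measurable_snd).aemeasurable, ?_⟩
  have hif : IndepFun Z ξ μ := by
    rw [IndepFun_iff_Indep]
    exact indep_of_indep_of_le_left hind.symm hZ.comap_le
  rw [(indepFun_iff_map_prod_eq_prod_map_map hZ'.aemeasurable hξ.aemeasurable).1 hif, hlaw]
  have h := Measure.map_prod_map μ D hZ' (measurable_id (α := Ξ))
  rw [Measure.map_id] at h
  exact h

variable [NormedAddCommGroup E] [InnerProductSpace ℝ E] [FiniteDimensional ℝ E]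
  [MeasurableSpace E] [BorelSpace E]

theorem integrable_inner_of_memLp {Ω E : Type*} [MeasurableSpace Ω] {μ : Measure Ω}
    [NormedAddCommGroup E] [InnerProductSpace ℝ E] {f g : Ω → E} (hf : MemLp f 2 μ)
    (hg : MemLp g 2 μ) : Integrable (fun ω => (inner ℝ (f ω) (g ω) : ℝ)) μ :=
  (hf.norm.integrable_mul hg.norm).mono' (hf.1.inner hg.1)
    (Filter.Eventually.of_forall fun ω => norm_inner_le_norm (f ω) (g ω))

/-- `N` has second moment at most `C`, and is orthogonal to everything that is `m`-measurable. -/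
structure CenteredNoise {Ω E : Type*} [NormedAddCommGroup E] [InnerProductSpace ℝ E]
    [MeasurableSpace E] [MeasurableSpace Ω] (μ : Measure Ω) (m : MeasurableSpace Ω) (C : ℝ) (N : Ω → E) : Prop where
  memLp : MemLp N 2 μ
  integral_norm_sq_le : ∫ ω, ‖N ω‖ ^ 2 ∂μ ≤ C
  orthogonal : ∀ S : Ω → E, Measurable[m] S → MemLp S 2 μ → ∫ ω, inner ℝ (S ω) (N ω) ∂μ = 0

theorem CenteredNoise.const_smul {Ω E : Type*} {m : MeasurableSpace Ω} [MeasurableSpace Ω]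
    {μ : Measure Ω} [NormedAddCommGroup E] [InnerProductSpace ℝ E] [MeasurableSpace E]
    {C : ℝ} {N : Ω → E} (h : CenteredNoise μ m C N) (r : ℝ) :
    CenteredNoise μ m (r ^ 2 * C) (r • N) where
  memLp := h.memLp.const_smul r
  integral_norm_sq_le := by
    simp only [Pi.smul_apply, norm_smul, mul_pow, Real.norm_eq_abs, sq_abs]
    rw [integral_const_mul]
    exact mul_le_mul_of_nonneg_left h.integral_norm_sq_le (sq_nonneg r)
  orthogonal S hS hS2 := by
    simp only [Pi.smul_apply, inner_smul_right]
    rw [integral_const_mul, h.orthogonal S hS hS2, mul_zero]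

/-- Independence turns the joint law of past and sample into a product, so Fubini allows integrating
the sample first with the past frozen. The mean and variance hypotheses at frozen arguments then
suffice, and no conditional expectation appears. -/
theorem centeredNoise_of_fresh_sample (hm : m ≤ mΩ) (hZ : Measurable[m] Z) (hξ : Measurable ξ)
    (hlaw : μ.map ξ = D) (hind : Indep (mΞ.comap ξ) m μ) {F : 𝒵 × Ξ → E} (hF : Measurable F)
    {C : ℝ} (hint : ∀ z, Integrable (fun s => F (z, s)) D) (hmean : ∀ z, ∫ s, F (z, s) ∂D = 0)
    (hsq : ∀ z, Integrable (fun s => ‖F (z, s)‖ ^ 2) D)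
    (hvar : ∀ᵐ ω ∂μ, ∫ s, ‖F (Z ω, s)‖ ^ 2 ∂D ≤ C) :
    CenteredNoise μ m C (fun ω => F (Z ω, ξ ω)) := by
  have hZ' : Measurable Z := hZ.mono hm le_rfl
  have hN : Measurable fun ω => F (Z ω, ξ ω) := hF.comp (hZ'.prodMk hξ)
  have hfresh := identDistrib_fresh_sample (Z := Z) hm hZ hξ hlaw hind
  have hid := hfresh.comp (u := fun p => ‖F p‖ ^ 2) (hF.norm.pow_const 2)
  have hFZ : Measurable fun p : Ω × Ξ => F (Z p.1, p.2) :=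
    hF.comp ((hZ'.comp measurable_fst).prodMk measurable_snd)
  have hnn : ∀ᵐ ω ∂μ, 0 ≤ ∫ s, ‖F (Z ω, s)‖ ^ 2 ∂D :=
    Filter.Eventually.of_forall fun ω => integral_nonneg fun s => sq_nonneg _
  have hmeas : AEStronglyMeasurable (fun ω => ∫ s, ‖F (Z ω, s)‖ ^ 2 ∂D) μ :=
    ((hFZ.norm.pow_const 2).stronglyMeasurable.integral_prod_right').aestronglyMeasurable
  have hI : Integrable (fun ω => ∫ s, ‖F (Z ω, s)‖ ^ 2 ∂D) μ := by
    refine (integrable_const C).mono' hmeas ?_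
    filter_upwards [hvar, hnn] with ω h1 h2
    rwa [Real.norm_of_nonneg h2]
  have hprod : Integrable (fun p : Ω × Ξ => ‖F (Z p.1, p.2)‖ ^ 2) (μ.prod D) := by
    rw [integrable_prod_iff (hFZ.norm.pow_const 2).aestronglyMeasurable]
    refine ⟨Filter.Eventually.of_forall fun ω => hsq (Z ω), ?_⟩
    simpa using hI
  have hsqint : Integrable (fun ω => ‖F (Z ω, ξ ω)‖ ^ 2) μ := hid.integrable_iff.2 hprod
  have hLp : MemLp (fun ω => F (Z ω, ξ ω)) 2 μ :=
    (memLp_two_iff_integrable_sq_norm hN.aestronglyMeasurable).2 hsqint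
  refine ⟨hLp, ?_, fun S hS hS2 => ?_⟩
  · have h1 : ∫ ω, ‖F (Z ω, ξ ω)‖ ^ 2 ∂μ = ∫ p : Ω × Ξ, ‖F (Z p.1, p.2)‖ ^ 2 ∂(μ.prod D) :=
      hid.integral_eq
    rw [h1, integral_prod _ hprod]
    calc ∫ ω, ∫ s, ‖F (Z ω, s)‖ ^ 2 ∂D ∂μ ≤ ∫ _, C ∂μ := integral_mono_ae hI (integrable_const C) hvar
      _ = C := by simp
  · have hfresh2 := identDistrib_fresh_sample (Z := fun ω => (S ω, Z ω)) hm (hS.prodMk hZ) hξ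
      hlaw hind
    have hφ : Measurable fun p : (E × 𝒵) × Ξ => (inner ℝ p.1.1 (F (p.1.2, p.2)) : ℝ) :=
      (measurable_fst.comp measurable_fst).inner
        (hF.comp ((measurable_snd.comp measurable_fst).prodMk measurable_snd))
    have hid2 := hfresh2.comp hφ
    have hi : Integrable (fun ω => (inner ℝ (S ω) (F (Z ω, ξ ω)) : ℝ)) μ := integrable_inner_of_memLp hS2 hLp
    have hi2 : Integrable (fun p : Ω × Ξ => (inner ℝ (S p.1) (F (Z p.1, p.2)) : ℝ)) (μ.prod D) :=
      hid2.integrable_iff.1 hi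
    have h1 : ∫ ω, inner ℝ (S ω) (F (Z ω, ξ ω)) ∂μ
        = ∫ p : Ω × Ξ, inner ℝ (S p.1) (F (Z p.1, p.2)) ∂(μ.prod D) := hid2.integral_eq
    rw [h1, integral_prod _ hi2]
    have h2 : ∀ ω, ∫ s, inner ℝ (S ω) (F (Z ω, s)) ∂D = 0 := fun ω => by
      rw [integral_inner (hint (Z ω)), hmean, inner_zero_right]
    simp [h2]

theorem integral_norm_le_sqrt {Ω E : Type*} [MeasurableSpace Ω] {μ : Measure Ω}
    [IsProbabilityMeasure μ] [NormedAddCommGroup E] {N : Ω → E} {C : ℝ} (hN : MemLp N 2 μ)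
    (hC : ∫ ω, ‖N ω‖ ^ 2 ∂μ ≤ C) : ∫ ω, ‖N ω‖ ∂μ ≤ √C := by
  have h1 := variance_nonneg (fun ω => ‖N ω‖) μ
  rw [variance_eq_sub hN.norm] at h1
  refine Real.le_sqrt_of_sq_le ?_
  have h2 : ∫ ω, ((fun ω => ‖N ω‖) ^ 2) ω ∂μ = ∫ ω, ‖N ω‖ ^ 2 ∂μ := rfl
  linarith

/-- The process `A 0 = 0`, `A (i + 1) = ρ A i + N i`. -/
def arSum (ρ : ℝ) (N : ℕ → Ω → E) : ℕ → Ω → E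
  | 0 => 0
  | i + 1 => ρ • arSum ρ N i + N i

/-- Second moment of a first-order autoregressive process with martingale-difference noise. -/
theorem arSum_second_moment {Ω : Type*} [mΩ : MeasurableSpace Ω] {μ : Measure Ω}
    {ℱ : Filtration ℕ mΩ} {N : ℕ → Ω → E} {β C : ℝ} {T : ℕ}
    (hβ : 0 < β) (hβ1 : β ≤ 1) (hC : 0 ≤ C)
    (hmeas : ∀ i < T, Measurable[ℱ (i + 2)] (N i))
    (hN : ∀ i < T, CenteredNoise μ (ℱ (i + 1)) C (N i)) :
    ∀ i ≤ T, Measurable[ℱ (i + 1)] (arSum (1 - β) N i) ∧ MemLp (arSum (1 - β) N i) 2 μ ∧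
      ∫ ω, ‖arSum (1 - β) N i ω‖ ^ 2 ∂μ ≤ C / β := by
  intro i
  induction i with
  | zero =>
    intro _
    refine ⟨measurable_const, MemLp.zero, ?_⟩
    simp only [arSum, Pi.zero_apply, norm_zero]
    norm_num
    positivity
  | succ i ih =>
    intro hi
    obtain ⟨h1, h2, h3⟩ := ih (by omega)
    have hNi := hN i (by omega)
    have hm : Measurable[ℱ (i + 1)] ((1 - β) • arSum (1 - β) N i) := h1.const_smul _
    have hL := h2.const_smul (1 - β)
    refine ⟨(hm.mono (ℱ.mono (by omega)) le_rfl).add (hmeas i (by omega)),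
      hL.add hNi.memLp, ?_⟩
    have hor := hNi.orthogonal _ hm hL
    have e1 : ∀ ω, ‖arSum (1 - β) N (i + 1) ω‖ ^ 2
        = (1 - β) ^ 2 * ‖arSum (1 - β) N i ω‖ ^ 2
          + 2 * inner ℝ (((1 - β) • arSum (1 - β) N i) ω) (N i ω) + ‖N i ω‖ ^ 2 := fun ω => by
      have : arSum (1 - β) N (i + 1) ω = ((1 - β) • arSum (1 - β) N i) ω + N i ω := rfl
      rw [this, norm_add_sq_real]
      simp only [Pi.smul_apply, norm_smul, mul_pow, Real.norm_eq_abs, sq_abs]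
    have i1 : Integrable (fun ω => (1 - β) ^ 2 * ‖arSum (1 - β) N i ω‖ ^ 2) μ :=
      (h2.integrable_norm_pow (by norm_num)).const_mul _
    have i2 : Integrable (fun ω => 2 * inner ℝ (((1 - β) • arSum (1 - β) N i) ω) (N i ω)) μ :=
      (integrable_inner_of_memLp hL hNi.memLp).const_mul 2
    have i3 : Integrable (fun ω => ‖N i ω‖ ^ 2) μ := hNi.memLp.integrable_norm_pow (by norm_num)
    simp only [e1]
    have i12 : Integrable (fun ω => (1 - β) ^ 2 * ‖arSum (1 - β) N i ω‖ ^ 2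
        + 2 * inner ℝ (((1 - β) • arSum (1 - β) N i) ω) (N i ω)) μ := i1.add i2
    rw [integral_add i12 i3, integral_add i1 i2, integral_const_mul, integral_const_mul,
      hor, mul_zero, add_zero]
    have h4 := hNi.integral_norm_sq_le
    -- C/β is stable under the recursion, with slack exactly C(1 - β).
    have h5 : (1 - β) ^ 2 * (C / β) + C ≤ C / β := by
      have : C / β - ((1 - β) ^ 2 * (C / β) + C) = C * (1 - β) := by field_simp; ring
      nlinarith
    nlinarith [sq_nonneg (1 - β)]

end Noise

/-! ### Joint iterates, joint momenta and their measurability. -/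

section Run

variable {M₁ M₂ : ℕ}

/-- The joint iterate `z = col{x, y}` of a run. -/
def Trajectory.z {Ω Ξ : Type*} (𝒯 : Trajectory M₁ M₂ Ω Ξ) (k : ℕ) (ω : Ω) : Joint M₁ M₂ :=
  col (𝒯.x k ω) (𝒯.y k ω)

/-- The joint momentum of a run. -/
def Trajectory.m {Ω Ξ : Type*} (𝒯 : Trajectory M₁ M₂ Ω Ξ) (k : ℕ) (ω : Ω) : Joint M₁ M₂ :=
  col (𝒯.mx k ω) (𝒯.my k ω)

theorem measurable_direction {n : ℕ} (lam : ℝ) :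
    Measurable fun p : EuclideanSpace ℝ (Fin n) × EuclideanSpace ℝ (Fin n) =>
      direction (scalingDiag lam p.1) p.2 := by
  have hpow : ∀ q : ℝ, Measurable
      fun p : EuclideanSpace ℝ (Fin n) × EuclideanSpace ℝ (Fin n) =>
        diagPowMul (scalingDiag lam p.1) q p.2 := fun q => by
    refine (WithLp.measurable_toLp 2 _).comp (measurable_pi_lambda _ fun j => ?_)
    have h1 : Measurable fun p : EuclideanSpace ℝ (Fin n) × EuclideanSpace ℝ (Fin n) => p.1 j := by
      fun_prop
    have h2 : Measurable fun p : EuclideanSpace ℝ (Fin n) × EuclideanSpace ℝ (Fin n) => p.2 j := by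
      fun_prop
    exact ((h1.sqrt.add_const lam).pow_const q).mul h2
  exact (hpow _).norm.inv.smul (hpow _)

variable {Ω Ξ : Type*} [mΩ : MeasurableSpace Ω] [mΞ : MeasurableSpace Ξ]
  {J : Joint M₁ M₂ → ℝ} {Q : Joint M₁ M₂ → Ξ → ℝ} {D : Measure Ξ} {μ : Measure Ω}
  {ℱ : Filtration ℕ mΩ} {σ σh β μx μy lam : ℝ} {T : ℕ} {𝒯 : Trajectory M₁ M₂ Ω Ξ}

theorem measurable_col {α : Type*} {mα : MeasurableSpace α}
    {f : α → EuclideanSpace ℝ (Fin M₁)} {g : α → EuclideanSpace ℝ (Fin M₂)} (hf : Measurable f)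
    (hg : Measurable g) : Measurable fun t => (col (f t) (g t) : Joint M₁ M₂) :=
  (WithLp.measurable_toLp 2 _).comp (hf.prodMk hg)

theorem measurable_fst_joint : Measurable fun z : Joint M₁ M₂ => z.fst :=
  measurable_fst.comp (WithLp.measurable_ofLp 2 _)

theorem measurable_snd_joint : Measurable fun z : Joint M₁ M₂ => z.snd :=
  measurable_snd.comp (WithLp.measurable_ofLp 2 _)

theorem measurable_clm_apply {α : Type*} {mα : MeasurableSpace α}
    {A : α → Joint M₁ M₂ →L[ℝ] Joint M₁ M₂} {v : α → Joint M₁ M₂} (hA : Measurable A)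
    (hv : Measurable v) : Measurable fun t => A t (v t) :=
  (isBoundedBilinearMap_apply (𝕜 := ℝ) (E := Joint M₁ M₂)
    (F := Joint M₁ M₂)).continuous.measurable.comp (hA.prodMk hv)

theorem StochasticLoss.measurable_momentum {α : Type*} {mα : MeasurableSpace α}
    (hQ : StochasticLoss Q D J σ σh) {m z z' : α → Joint M₁ M₂} {s : α → Ξ} (hm : Measurable m)
    (hz : Measurable z) (hz' : Measurable z') (hs : Measurable s) :
    Measurable fun t => (1 - β) • (m t + hessian (fun z => Q z (s t)) (z' t) (z' t - z t))
      + β • gradient (fun z => Q z (s t)) (z' t) := by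
  have h1 : Measurable fun t => gradient (fun z => Q z (s t)) (z' t) :=
    hQ.measurable_gradient.comp (hz'.prodMk hs)
  have h2 : Measurable fun t => hessian (fun z => Q z (s t)) (z' t) :=
    hQ.measurable_hessian.comp (hz'.prodMk hs)
  have h3 := measurable_clm_apply h2 (hz'.sub hz)
  exact ((hm.add h3).const_smul (1 - β)).add (h1.const_smul β)

theorem measurable_step {α : Type*} {mα : MeasurableSpace α} {n : ℕ}
    {x v m : α → EuclideanSpace ℝ (Fin n)} (hx : Measurable x) (hv : Measurable v)
    (hm : Measurable m) (lam r : ℝ) :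
    Measurable fun t => x t + r • direction (scalingDiag lam (v t)) (m t) :=
  hx.add (((measurable_direction lam).comp (hv.prodMk hm)).const_smul r)

theorem IsRun.m_zero (h : IsRun Q D μ ℱ β 1 μx μy lam T 𝒯) (ω : Ω) :
    𝒯.m 0 ω = gradient (fun z => Q z (𝒯.ξ 0 ω)) (𝒯.z 0 ω) := by
  rw [Trajectory.m, h.mx_init, h.my_init]
  rfl

theorem IsRun.m_succ (h : IsRun Q D μ ℱ β 1 μx μy lam T 𝒯) {i : ℕ} (hi : i < T) (ω : Ω) :
    𝒯.m (i + 1) ω = (1 - β) • (𝒯.m i ω + hessian (fun z => Q z (𝒯.ξ (i + 1) ω)) (𝒯.z (i + 1) ω)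
        (𝒯.z (i + 1) ω - 𝒯.z i ω))
      + β • gradient (fun z => Q z (𝒯.ξ (i + 1) ω)) (𝒯.z (i + 1) ω) := by
  rw [Trajectory.m, h.mx_update i hi, h.my_update i hi]
  simp only [one_smul]
  rfl

/-- The iterates are known before, and the momenta after, the sample of the same index is drawn. -/
theorem IsRun.measurable (hQ : StochasticLoss Q D J σ σh)
    (h : IsRun Q D μ ℱ β 1 μx μy lam T 𝒯) :
    ∀ k ≤ T, Measurable[ℱ k] (𝒯.z k) ∧ Measurable[ℱ (k + 1)] (𝒯.m k) ∧
      Measurable[ℱ (k + 1)] (𝒯.z (k + 1)) := by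
  intro k
  induction k with
  | zero =>
    intro _
    have hz : Measurable[ℱ 0] (𝒯.z 0) := measurable_col h.x_prev_measurable h.y_prev_measurable
    refine ⟨hz, ?_, measurable_col h.x_init_measurable h.y_init_measurable⟩
    have := hQ.measurable_gradient.comp ((hz.mono (ℱ.mono (Nat.zero_le 1)) le_rfl).prodMk
      (h.sample_measurable 0 (Nat.zero_le _)))
    rwa [show 𝒯.m 0 = _ from funext h.m_zero]
  | succ i ih =>
    intro hi
    obtain ⟨hz, hm, hz'⟩ := ih (by omega)
    have hi' : i < T := by omega
    have hle : ℱ (i + 1) ≤ ℱ (i + 1 + 1) := ℱ.mono (by omega)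
    have hz2 := hz'.mono hle le_rfl
    have hz1 := (hz.mono (ℱ.mono (by omega : i ≤ i + 1)) le_rfl).mono hle le_rfl
    have hm' : Measurable[ℱ (i + 1 + 1)] (𝒯.m (i + 1)) := by
      rw [show 𝒯.m (i + 1) = _ from funext (h.m_succ hi')]
      exact hQ.measurable_momentum (hm.mono hle le_rfl) hz1 hz2 (h.sample_measurable (i + 1) hi)
    refine ⟨hz', hm', ?_⟩
    have hx : Measurable[ℱ (i + 1 + 1)] (𝒯.x (i + 1 + 1)) := by
      have := measurable_step (measurable_fst_joint.comp hz2) (h.vx_measurable i hi')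
        (measurable_fst_joint.comp hm') lam (-μx)
      rw [show 𝒯.x (i + 1 + 1) = _ from funext (h.x_update i hi')]
      simp only [neg_smul, ← sub_eq_add_neg] at this
      exact this
    have hy : Measurable[ℱ (i + 1 + 1)] (𝒯.y (i + 1 + 1)) := by
      rw [show 𝒯.y (i + 1 + 1) = _ from funext (h.y_update i hi')]
      exact measurable_step (measurable_snd_joint.comp hz2) (h.vy_measurable i hi')
        (measurable_snd_joint.comp hm') lam μy
    exact measurable_col hx hy

end Run

/-! ### The momentum as an estimate of the gradient. -/

section MomentumError

variable {M₁ M₂ : ℕ} {Ω Ξ : Type*} [mΩ : MeasurableSpace Ω] [mΞ : MeasurableSpace Ξ]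
  {J : Joint M₁ M₂ → ℝ} {Q : Joint M₁ M₂ → Ξ → ℝ} {D : Measure Ξ} {μ : Measure Ω}
  {ℱ : Filtration ℕ mΩ} {Lf Lh σ σh a b β μx μy lam : ℝ} {T : ℕ} {𝒯 : Trajectory M₁ M₂ Ω Ξ}

/-- The error of the stochastic gradient with sample `k`. -/
noncomputable def gradNoise (Q : Joint M₁ M₂ → Ξ → ℝ) (J : Joint M₁ M₂ → ℝ) (𝒯 : Trajectory M₁ M₂ Ω Ξ) (k : ℕ)
    (ω : Ω) : Joint M₁ M₂ :=
  gradient (fun z => Q z (𝒯.ξ k ω)) (𝒯.z k ω) - gradient J (𝒯.z k ω)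

/-- The error of the stochastic Hessian-vector product with sample `k + 1`. -/
noncomputable def hvpNoise (Q : Joint M₁ M₂ → Ξ → ℝ) (J : Joint M₁ M₂ → ℝ) (𝒯 : Trajectory M₁ M₂ Ω Ξ) (k : ℕ)
    (ω : Ω) : Joint M₁ M₂ :=
  (hessian (fun z => Q z (𝒯.ξ (k + 1) ω)) (𝒯.z (k + 1) ω) - hessian J (𝒯.z (k + 1) ω))
    (𝒯.z (k + 1) ω - 𝒯.z k ω)

/-- The error of the momentum as an estimate of the gradient. -/
noncomputable def momentumError (J : Joint M₁ M₂ → ℝ) (𝒯 : Trajectory M₁ M₂ Ω Ξ) (k : ℕ) (ω : Ω) :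
    Joint M₁ M₂ :=
  𝒯.m k ω - gradient J (𝒯.z k ω)

theorem measurable_gradNoise (hL : LipschitzCost J Lf Lh) (hQ : StochasticLoss Q D J σ σh)
    (h : IsRun Q D μ ℱ β 1 μx μy lam T 𝒯) {k : ℕ} (hk : k ≤ T) :
    Measurable[ℱ (k + 1)] (gradNoise Q J 𝒯 k) := by
  have hz := ((h.measurable hQ k hk).1).mono (ℱ.mono (Nat.le_succ k)) le_rfl
  exact (hQ.measurable_gradient.comp (hz.prodMk (h.sample_measurable k hk))).sub
    (hL.contDiff_gradient.continuous.measurable.comp hz)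

theorem measurable_hvpNoise (hL : LipschitzCost J Lf Lh) (hQ : StochasticLoss Q D J σ σh)
    (h : IsRun Q D μ ℱ β 1 μx μy lam T 𝒯) {i : ℕ} (hi : i < T) :
    Measurable[ℱ (i + 2)] (hvpNoise Q J 𝒯 i) := by
  have hz := ((h.measurable hQ (i + 1) hi).1).mono (ℱ.mono (Nat.le_succ (i + 1))) le_rfl
  have hz' := ((h.measurable hQ i hi.le).1).mono (ℱ.mono (by omega : i ≤ i + 2)) le_rfl
  exact measurable_clm_apply
    ((hQ.measurable_hessian.comp (hz.prodMk (h.sample_measurable (i + 1) hi))).sub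
      (hL.continuous_hessian.measurable.comp hz)) (hz.sub hz')

theorem measurable_momentumError (hL : LipschitzCost J Lf Lh) (hQ : StochasticLoss Q D J σ σh)
    (h : IsRun Q D μ ℱ β 1 μx μy lam T 𝒯) {k : ℕ} (hk : k ≤ T) :
    Measurable (momentumError J 𝒯 k) :=
  ((h.measurable hQ k hk).2.1.mono (ℱ.le _) le_rfl).sub
    (hL.contDiff_gradient.continuous.measurable.comp
      ((h.measurable hQ k hk).1.mono (ℱ.le _) le_rfl))

theorem centeredNoise_gradNoise [IsProbabilityMeasure μ] [IsProbabilityMeasure D]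
    (hL : LipschitzCost J Lf Lh) (hQ : StochasticLoss Q D J σ σh)
    (h : IsRun Q D μ ℱ β 1 μx μy lam T 𝒯) {k : ℕ} (hk : k ≤ T) :
    CenteredNoise μ (ℱ k) (σ ^ 2) (gradNoise Q J 𝒯 k) := by
  refine centeredNoise_of_fresh_sample
    (F := fun p : Joint M₁ M₂ × Ξ => gradient (fun z => Q z p.2) p.1 - gradient J p.1) (Z := 𝒯.z k)
    (D := D) (ξ := 𝒯.ξ k) (ℱ.le k) (h.measurable hQ k hk).1
    ((h.sample_measurable k hk).mono (ℱ.le _) le_rfl) (h.sample_law k hk) (h.sample_indep k hk)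
    (hQ.measurable_gradient.sub (hL.contDiff_gradient.continuous.measurable.comp measurable_fst))
    (fun z => (hQ.integrable_gradient z).sub (integrable_const (gradient J z))) (fun z => ?_)
    hQ.integrable_gradient_sq (Filter.Eventually.of_forall fun ω => hQ.gradient_variance (𝒯.z k ω))
  change ∫ s, (gradient (fun z' => Q z' s) z - gradient J z) ∂D = 0
  rw [integral_sub (hQ.integrable_gradient z) (integrable_const _), hQ.gradient_unbiased]
  simp

theorem integral_hessian_sub_apply [IsProbabilityMeasure D] (hQ : StochasticLoss Q D J σ σh)
    (z v : Joint M₁ M₂) :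
    ∫ s, (hessian (fun z' => Q z' s) z - hessian J z) v ∂D = 0 := by
  have h1 := ContinuousLinearMap.integral_apply (hQ.integrable_hessian z) v
  rw [hQ.hessian_unbiased] at h1
  simp only [_root_.sub_apply]
  rw [integral_sub ((hQ.integrable_hessian z).apply_continuousLinearMap v) (integrable_const _),
    ← h1, integral_const, probReal_univ, one_smul, sub_self]

/-- The displacement is known before sample i + 1 is drawn, so it acts as a constant vector: the
mean stays zero and the variance is multiplied by at most the squared displacement. Short steps thus
make this noise small. -/
theorem centeredNoise_hvpNoise [IsProbabilityMeasure μ] [IsProbabilityMeasure D]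
    (hL : LipschitzCost J Lf Lh) (hQ : StochasticLoss Q D J σ σh)
    (h : IsRun Q D μ ℱ β 1 μx μy lam T 𝒯) {i : ℕ} (hi : i < T) {ρ : ℝ}
    (hρ : ∀ᵐ ω ∂μ, ‖𝒯.z (i + 1) ω - 𝒯.z i ω‖ ^ 2 ≤ ρ) :
    CenteredNoise μ (ℱ (i + 1)) (σh ^ 2 * ρ) (hvpNoise Q J 𝒯 i) := by
  have hA : ∀ z, Integrable (fun s => hessian (fun z' => Q z' s) z - hessian J z) D :=
    fun z => (hQ.integrable_hessian z).sub (integrable_const _)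
  have hsq : ∀ p : Joint M₁ M₂ × Joint M₁ M₂, ∀ s : Ξ,
      ‖(hessian (fun z => Q z s) p.1 - hessian J p.1) (p.1 - p.2)‖ ^ 2
        ≤ ‖hessian (fun z => Q z s) p.1 - hessian J p.1‖ ^ 2 * ‖p.1 - p.2‖ ^ 2 := fun p s => by
    rw [← mul_pow]
    exact pow_le_pow_left₀ (norm_nonneg _) (ContinuousLinearMap.le_opNorm _ _) 2
  have hint : ∀ p : Joint M₁ M₂ × Joint M₁ M₂, Integrable
      (fun s => ‖(hessian (fun z => Q z s) p.1 - hessian J p.1) (p.1 - p.2)‖ ^ 2) D := fun p => by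
    refine ((hQ.integrable_hessian_sq p.1).mul_const (‖p.1 - p.2‖ ^ 2)).mono'
      (((hA p.1).apply_continuousLinearMap (p.1 - p.2)).1.norm.pow 2)
      (Filter.Eventually.of_forall fun s => ?_)
    rw [Real.norm_of_nonneg (sq_nonneg _)]
    exact hsq p s
  have hz := (h.measurable hQ (i + 1) hi).1
  have hz' := ((h.measurable hQ i hi.le).1).mono (ℱ.mono (Nat.le_succ i)) le_rfl
  refine centeredNoise_of_fresh_sample
    (F := fun p : (Joint M₁ M₂ × Joint M₁ M₂) × Ξ =>
      (hessian (fun z => Q z p.2) p.1.1 - hessian J p.1.1) (p.1.1 - p.1.2))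
    (Z := fun ω => (𝒯.z (i + 1) ω, 𝒯.z i ω)) (D := D) (ξ := 𝒯.ξ (i + 1)) (ℱ.le _) (hz.prodMk hz')
    ((h.sample_measurable (i + 1) hi).mono (ℱ.le _) le_rfl) (h.sample_law (i + 1) hi)
    (h.sample_indep (i + 1) hi) ?_ (fun p => (hA p.1).apply_continuousLinearMap (p.1 - p.2))
    (fun p => ?_) hint ?_
  · have h1 : Measurable fun p : (Joint M₁ M₂ × Joint M₁ M₂) × Ξ => p.1.1 :=
      measurable_fst.comp measurable_fst
    have h2 : Measurable fun p : (Joint M₁ M₂ × Joint M₁ M₂) × Ξ => p.1.2 :=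
      measurable_snd.comp measurable_fst
    exact measurable_clm_apply ((hQ.measurable_hessian.comp (h1.prodMk measurable_snd)).sub
      (hL.continuous_hessian.measurable.comp h1)) (h1.sub h2)
  · exact integral_hessian_sub_apply hQ p.1 (p.1 - p.2)
  · filter_upwards [hρ] with ω hω
    calc ∫ s, ‖(hessian (fun z => Q z s) (𝒯.z (i + 1) ω) - hessian J (𝒯.z (i + 1) ω))
            (𝒯.z (i + 1) ω - 𝒯.z i ω)‖ ^ 2 ∂D
        ≤ ∫ s, ‖hessian (fun z => Q z s) (𝒯.z (i + 1) ω) - hessian J (𝒯.z (i + 1) ω)‖ ^ 2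
            * ‖𝒯.z (i + 1) ω - 𝒯.z i ω‖ ^ 2 ∂D :=
          integral_mono (hint (𝒯.z (i + 1) ω, 𝒯.z i ω))
            ((hQ.integrable_hessian_sq _).mul_const _)
            (hsq (𝒯.z (i + 1) ω, 𝒯.z i ω))
      _ = (∫ s, ‖hessian (fun z => Q z s) (𝒯.z (i + 1) ω) - hessian J (𝒯.z (i + 1) ω)‖ ^ 2 ∂D)
            * ‖𝒯.z (i + 1) ω - 𝒯.z i ω‖ ^ 2 := integral_mul_const _ _
      _ ≤ σh ^ 2 * ρ :=
          mul_le_mul (hQ.hessian_variance _) hω (sq_nonneg _) (sq_nonneg _)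

/-- Consecutive iterates are close. -/
theorem norm_z_sub_sq_le (ha : 0 < a) (hμx : 0 < μx) (hμy : 0 < μy)
    (h : IsRun Q D μ ℱ β 1 μx μy lam T 𝒯) (hs : ScalingBounded μ a b lam T 𝒯)
    (hc : StartClose μ a μx μy 𝒯) {i : ℕ} (hi : i ≤ T) :
    ∀ᵐ ω ∂μ, ‖𝒯.z (i + 1) ω - 𝒯.z i ω‖ ^ 2 ≤ (μx ^ 2 + μy ^ 2) / a := by
  have hbound : ∀ ω, ‖𝒯.x (i + 1) ω - 𝒯.x i ω‖ ≤ μx / √a → ‖𝒯.y (i + 1) ω - 𝒯.y i ω‖ ≤ μy / √a →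
      ‖𝒯.z (i + 1) ω - 𝒯.z i ω‖ ^ 2 ≤ (μx ^ 2 + μy ^ 2) / a := fun ω h1 h2 => by
    rw [WithLp.prod_norm_sq_eq_of_L2, add_div]
    have e : √a ^ 2 = a := Real.sq_sqrt ha.le
    have h3 := pow_le_pow_left₀ (norm_nonneg _) h1 2
    have h4 := pow_le_pow_left₀ (norm_nonneg _) h2 2
    rw [div_pow, e] at h3 h4
    exact add_le_add h3 h4
  rcases i with _ | i
  · filter_upwards [hc] with ω hω using hbound ω hω.1 hω.2
  · filter_upwards [hs i hi] with ω hω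
    refine hbound ω ?_ ?_
    · rw [h.x_update i hi, sub_sub_cancel_left, norm_neg, norm_smul, Real.norm_of_nonneg hμx.le,
        div_eq_mul_one_div]
      exact mul_le_mul_of_nonneg_left (norm_direction_le ha hω.1 _) hμx.le
    · rw [h.y_update i hi, add_sub_cancel_left, norm_smul, Real.norm_of_nonneg hμy.le,
        div_eq_mul_one_div]
      exact mul_le_mul_of_nonneg_left (norm_direction_le ha hω.2 _) hμy.le

/-- The exact Hessian part of the correction cancels the first-order change of the gradient. The
last term is the Taylor remainder based at the new iterate, hence quadratic in the displacement. -/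
theorem momentumError_succ (h : IsRun Q D μ ℱ β 1 μx μy lam T 𝒯) {i : ℕ} (hi : i < T) (ω : Ω) :
    momentumError J 𝒯 (i + 1) ω = (1 - β) • momentumError J 𝒯 i ω
      + (1 - β) • hvpNoise Q J 𝒯 i ω + β • gradNoise Q J 𝒯 (i + 1) ω
      + (1 - β) • (gradient J (𝒯.z i ω) - gradient J (𝒯.z (i + 1) ω)
        - hessian J (𝒯.z (i + 1) ω) (𝒯.z i ω - 𝒯.z (i + 1) ω)) := by
  rw [momentumError, h.m_succ hi, momentumError, hvpNoise, gradNoise,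
    _root_.sub_apply, ← neg_sub (𝒯.z (i + 1) ω) (𝒯.z i ω), map_neg]
  module

/-- The momentum error is the discounted initial error plus two autoregressive sums of noise, up
to a deterministic bound for the linearization errors. -/
theorem norm_momentumError_le (hL : LipschitzCost J Lf Lh) (hLh : 0 ≤ Lh) (hβ : 0 < β)
    (hβ1 : β ≤ 1) (h : IsRun Q D μ ℱ β 1 μx μy lam T 𝒯) {ρ : ℝ} {ω : Ω} (hρ0 : 0 ≤ ρ)
    (hρ : ∀ i < T, ‖𝒯.z (i + 1) ω - 𝒯.z i ω‖ ^ 2 ≤ ρ) :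
    ∀ i ≤ T, ‖momentumError J 𝒯 i ω‖ ≤ (1 - β) ^ i * ‖momentumError J 𝒯 0 ω‖
      + Lh * ρ / (2 * β)
      + ‖arSum (1 - β) (fun k => (1 - β) • hvpNoise Q J 𝒯 k) i ω‖
      + ‖arSum (1 - β) (fun k => β • gradNoise Q J 𝒯 (k + 1)) i ω‖ := by
  set V := arSum (1 - β) (fun k => (1 - β) • hvpNoise Q J 𝒯 k) with hV
  set W := arSum (1 - β) (fun k => β • gradNoise Q J 𝒯 (k + 1)) with hW
  have hβ' : 0 ≤ 1 - β := by linarith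
  have hrem : ∀ i ≤ T, ‖momentumError J 𝒯 i ω - (1 - β) ^ i • momentumError J 𝒯 0 ω - V i ω - W i ω‖
      ≤ Lh * ρ / (2 * β) := by
    intro i
    induction i with
    | zero =>
      intro _
      simp only [hV, hW, arSum, pow_zero, one_smul, sub_self, Pi.zero_apply, norm_zero]
      positivity
    | succ i ih =>
      intro hi
      have hR := hL.norm_gradient_sub_sub_le (𝒯.z (i + 1) ω) (𝒯.z i ω)
      rw [norm_sub_rev (𝒯.z i ω)] at hR
      have hR2 := hR.trans (mul_le_mul_of_nonneg_left (hρ i hi) (by positivity : 0 ≤ Lh / 2))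
      have e : momentumError J 𝒯 (i + 1) ω - (1 - β) ^ (i + 1) • momentumError J 𝒯 0 ω
          - V (i + 1) ω - W (i + 1) ω
          = (1 - β) • ((momentumError J 𝒯 i ω - (1 - β) ^ i • momentumError J 𝒯 0 ω - V i ω - W i ω)
            + (gradient J (𝒯.z i ω) - gradient J (𝒯.z (i + 1) ω)
              - hessian J (𝒯.z (i + 1) ω) (𝒯.z i ω - 𝒯.z (i + 1) ω))) := by
        have hV' : V (i + 1) ω = (1 - β) • V i ω + (1 - β) • hvpNoise Q J 𝒯 i ω := rfl
        have hW' : W (i + 1) ω = (1 - β) • W i ω + β • gradNoise Q J 𝒯 (i + 1) ω := rfl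
        rw [hV', hW', momentumError_succ h hi, pow_succ]
        module
      rw [e, norm_smul, Real.norm_of_nonneg hβ']
      refine (mul_le_mul_of_nonneg_left (norm_add_le_of_le (ih (by omega)) hR2) hβ').trans ?_
      -- The bound Lhρ/(2β) is preserved by one discounted step that adds a remainder of size Lhρ/2.
      have : Lh * ρ / (2 * β) - (1 - β) * (Lh * ρ / (2 * β) + Lh / 2 * ρ) = Lh * ρ * β / 2 := by
        field_simp
        ring
      have : 0 ≤ Lh * ρ * β / 2 := by positivity
      linarith
  intro i hi
  have hs : momentumError J 𝒯 i ω
      = (1 - β) ^ i • momentumError J 𝒯 0 ω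
        + (momentumError J 𝒯 i ω - (1 - β) ^ i • momentumError J 𝒯 0 ω - V i ω - W i ω)
        + V i ω + W i ω := by abel
  have h1 := norm_add₃_le (a := (1 - β) ^ i • momentumError J 𝒯 0 ω
        + (momentumError J 𝒯 i ω - (1 - β) ^ i • momentumError J 𝒯 0 ω - V i ω - W i ω))
        (b := V i ω) (c := W i ω)
  rw [← hs] at h1
  have h2 := norm_add_le ((1 - β) ^ i • momentumError J 𝒯 0 ω)
    (momentumError J 𝒯 i ω - (1 - β) ^ i • momentumError J 𝒯 0 ω - V i ω - W i ω)
  rw [norm_smul, Real.norm_of_nonneg (pow_nonneg hβ' i)] at h2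
  have h3 := hrem i hi
  linarith

/-- Bound on the expected momentum error at each time. -/
theorem integral_norm_momentumError_le [IsProbabilityMeasure μ] [IsProbabilityMeasure D]
    (hL : LipschitzCost J Lf Lh) (hLh : 0 ≤ Lh) (hσ : 0 ≤ σ) (hσh : 0 ≤ σh) (hβ : 0 < β)
    (hβ1 : β ≤ 1) (hQ : StochasticLoss Q D J σ σh) (h : IsRun Q D μ ℱ β 1 μx μy lam T 𝒯) {ρ : ℝ}
    (hρ0 : 0 ≤ ρ) (hρ : ∀ i < T, ∀ᵐ ω ∂μ, ‖𝒯.z (i + 1) ω - 𝒯.z i ω‖ ^ 2 ≤ ρ) {i : ℕ} (hi : i ≤ T) :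
    Integrable (fun ω => ‖momentumError J 𝒯 i ω‖) μ ∧
      ∫ ω, ‖momentumError J 𝒯 i ω‖ ∂μ ≤
        (1 - β) ^ i * σ + Lh * ρ / (2 * β) + σh * √(ρ / β) + σ * √β := by
  have hβ' : 0 ≤ 1 - β := by linarith
  -- The momentum starts as a stochastic gradient, so the initial error is pure sampling noise of
  -- size σ.
  have h0 : CenteredNoise μ (ℱ 0) (σ ^ 2) (momentumError J 𝒯 0) := by
    have e : momentumError J 𝒯 0 = gradNoise Q J 𝒯 0 := funext fun ω => by
      rw [momentumError, h.m_zero, gradNoise]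
    rw [e]
    exact centeredNoise_gradNoise hL hQ h (Nat.zero_le _)
  obtain ⟨-, hV, hV2⟩ := arSum_second_moment (μ := μ) (ℱ := ℱ)
    (N := fun k => (1 - β) • hvpNoise Q J 𝒯 k) (C := (1 - β) ^ 2 * (σh ^ 2 * ρ)) (T := T) hβ hβ1
    (by positivity) (fun i hi => (measurable_hvpNoise hL hQ h hi).const_smul (1 - β))
    (fun i hi => (centeredNoise_hvpNoise hL hQ h hi (hρ i hi)).const_smul (1 - β)) i hi
  -- The weight β² beats the accumulation factor 1/β, leaving second moment βσ²; the Hessian noise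
  -- above has no such weight and keeps its 1/β.
  obtain ⟨-, hW, hW2⟩ := arSum_second_moment (μ := μ) (ℱ := ℱ)
    (N := fun k => β • gradNoise Q J 𝒯 (k + 1)) (C := β ^ 2 * σ ^ 2) (T := T) hβ hβ1
    (by positivity) (fun i hi => (measurable_gradNoise hL hQ h hi).const_smul β)
    (fun i hi => (centeredNoise_gradNoise hL hQ h hi).const_smul β) i hi
  set V := arSum (1 - β) (fun k => (1 - β) • hvpNoise Q J 𝒯 k)
  set W := arSum (1 - β) (fun k => β • gradNoise Q J 𝒯 (k + 1))
  have i0 : Integrable (fun ω => ‖momentumError J 𝒯 0 ω‖) μ := (h0.memLp.integrable (by norm_num)).norm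
  have iV : Integrable (fun ω => ‖V i ω‖) μ := (hV.integrable (by norm_num)).norm
  have iW : Integrable (fun ω => ‖W i ω‖) μ := (hW.integrable (by norm_num)).norm
  have hle : ∀ᵐ ω ∂μ, ‖momentumError J 𝒯 i ω‖ ≤ (1 - β) ^ i * ‖momentumError J 𝒯 0 ω‖
      + Lh * ρ / (2 * β) + ‖V i ω‖ + ‖W i ω‖ := by
    have hall : ∀ᵐ ω ∂μ, ∀ i, i < T → ‖𝒯.z (i + 1) ω - 𝒯.z i ω‖ ^ 2 ≤ ρ :=
      ae_all_iff.2 fun i => by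
        by_cases hi : i < T
        · filter_upwards [hρ i hi] with ω hω _ using hω
        · exact Filter.Eventually.of_forall fun ω h => absurd h hi
    filter_upwards [hall] with ω hω
    exact norm_momentumError_le hL hLh hβ hβ1 h hρ0 hω i hi
  have iA : Integrable (fun ω => (1 - β) ^ i * ‖momentumError J 𝒯 0 ω‖ + Lh * ρ / (2 * β)) μ :=
    (i0.const_mul _).add (integrable_const _)
  have iB : Integrable (fun ω => (1 - β) ^ i * ‖momentumError J 𝒯 0 ω‖ + Lh * ρ / (2 * β)
      + ‖V i ω‖) μ := iA.add iV
  have iC : Integrable (fun ω => (1 - β) ^ i * ‖momentumError J 𝒯 0 ω‖ + Lh * ρ / (2 * β)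
      + ‖V i ω‖ + ‖W i ω‖) μ := iB.add iW
  have iE : Integrable (fun ω => ‖momentumError J 𝒯 i ω‖) μ := by
    refine iC.mono' (measurable_momentumError hL hQ h hi).norm.aestronglyMeasurable ?_
    filter_upwards [hle] with ω hω
    rwa [norm_norm]
  refine ⟨iE, (integral_mono_ae iE iC hle).trans ?_⟩
  rw [integral_add iB iW, integral_add iA iV, integral_add (i0.const_mul _) (integrable_const _),
    integral_const_mul]
  simp only [integral_const, probReal_univ, one_smul]
  have b0 : ∫ ω, ‖momentumError J 𝒯 0 ω‖ ∂μ ≤ σ := by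
    have := integral_norm_le_sqrt h0.memLp h0.integral_norm_sq_le
    rwa [Real.sqrt_sq hσ] at this
  have bV : ∫ ω, ‖V i ω‖ ∂μ ≤ σh * √(ρ / β) := by
    refine (integral_norm_le_sqrt hV hV2).trans ?_
    have e : σh * √(ρ / β) = √(σh ^ 2 * ρ / β) := by
      rw [mul_div_assoc, Real.sqrt_mul (sq_nonneg _), Real.sqrt_sq hσh]
    rw [e]
    refine Real.sqrt_le_sqrt (div_le_div_of_nonneg_right ?_ hβ.le)
    exact mul_le_of_le_one_left (by positivity) (pow_le_one₀ hβ' (by linarith))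
  have bW : ∫ ω, ‖W i ω‖ ∂μ ≤ σ * √β := by
    refine (integral_norm_le_sqrt hW hW2).trans_eq ?_
    rw [show β ^ 2 * σ ^ 2 / β = σ ^ 2 * β by field_simp, Real.sqrt_mul (sq_nonneg _),
      Real.sqrt_sq hσ]
  have := mul_le_mul_of_nonneg_left b0 (pow_nonneg hβ' i)
  linarith

/-- Bound on the sum of the expected momentum errors over a run. -/
theorem sum_integral_norm_momentumError_le [IsProbabilityMeasure μ] [IsProbabilityMeasure D]
    (hL : LipschitzCost J Lf Lh) (hLh : 0 ≤ Lh) (hσ : 0 ≤ σ) (hσh : 0 ≤ σh) (hβ : 0 < β)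
    (hβ1 : β ≤ 1) (hQ : StochasticLoss Q D J σ σh) (h : IsRun Q D μ ℱ β 1 μx μy lam T 𝒯) {ρ : ℝ}
    (hρ0 : 0 ≤ ρ) (hρ : ∀ i < T, ∀ᵐ ω ∂μ, ‖𝒯.z (i + 1) ω - 𝒯.z i ω‖ ^ 2 ≤ ρ) :
    ∑ i ∈ Finset.range T, ∫ ω, ‖momentumError J 𝒯 (i + 1) ω‖ ∂μ ≤
        σ / β + T * (Lh * ρ / (2 * β) + σh * √(ρ / β) + σ * √β) := by
  have hβ' : 0 ≤ 1 - β := by linarith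
  have hstep : ∀ i ∈ Finset.range T, ∫ ω, ‖momentumError J 𝒯 (i + 1) ω‖ ∂μ ≤
      (1 - β) ^ i * σ + (Lh * ρ / (2 * β) + σh * √(ρ / β) + σ * √β) := fun i hi => by
    have h1 := (integral_norm_momentumError_le hL hLh hσ hσh hβ hβ1 hQ h hρ0 hρ
      (i := i + 1) (Finset.mem_range.1 hi)).2
    -- Index i + 1 is time i, so the sum starts one discount late; giving that factor back leaves a
    -- geometric sum of at most 1/β.
    have h2 : (1 - β) ^ (i + 1) * σ ≤ (1 - β) ^ i * σ :=
      mul_le_mul_of_nonneg_right (pow_le_pow_of_le_one hβ' (by linarith) (Nat.le_succ i)) hσ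
    linarith
  refine (Finset.sum_le_sum hstep).trans ?_
  rw [Finset.sum_add_distrib, ← Finset.sum_mul, Finset.sum_const, Finset.card_range, nsmul_eq_mul]
  have hgeo : (∑ i ∈ Finset.range T, (1 - β) ^ i) * β ≤ 1 := by
    have := geom_sum_mul_neg (1 - β) T
    rw [sub_sub_cancel] at this
    rw [this]
    linarith [pow_nonneg hβ' T]
  have h3 : (∑ i ∈ Finset.range T, (1 - β) ^ i) * σ ≤ σ / β := by
    rw [le_div_iff₀ hβ]
    nlinarith
  linarith

end MomentumError

/-! ### Signs of the initial quantities. -/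

section Start

variable {M₁ M₂ : ℕ} {Ω Ξ : Type*} [MeasurableSpace Ω] {J : Joint M₁ M₂ → ℝ} {μ : Measure Ω}
  {ν : ℝ} {𝒯 : Trajectory M₁ M₂ Ω Ξ}

theorem startEnvelopeGap_nonneg [IsProbabilityMeasure μ] (hP : PLCost J ν)
    (hI : StartIntegrable μ J 𝒯) : 0 ≤ startEnvelopeGap μ J 𝒯 := by
  have h1 : ∫ _, envelopeInf J ∂μ ≤ ∫ ω, envelope J (𝒯.x 1 ω) ∂μ :=
    integral_mono (integrable_const _) hI.1 fun ω => hP.envelopeInf_le _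
  rw [integral_const, probReal_univ, one_smul] at h1
  exact sub_nonneg.2 h1

theorem startGap_nonneg (hP : PLCost J ν) : 0 ≤ startGap μ J 𝒯 :=
  integral_nonneg fun _ => sub_nonneg.2 (hP.le_envelope _ _)

theorem startDist_nonneg : 0 ≤ startDist μ J 𝒯 :=
  integral_nonneg fun _ => Metric.infDist_nonneg

end Start

/-! ### Expectations and the explicit bound. -/

section ExplicitBound

variable {M₁ M₂ : ℕ} {Ω Ξ : Type*} [mΩ : MeasurableSpace Ω] [mΞ : MeasurableSpace Ξ]
  {J : Joint M₁ M₂ → ℝ} {Q : Joint M₁ M₂ → Ξ → ℝ} {D : Measure Ξ} {μ : Measure Ω}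
  {ℱ : Filtration ℕ mΩ} {ν Lf Lh σ σh a b β μx μy lam : ℝ} {T : ℕ} {𝒯 : Trajectory M₁ M₂ Ω Ξ}

theorem measurable_gradNorms (hL : LipschitzCost J Lf Lh) (hQ : StochasticLoss Q D J σ σh)
    (h : IsRun Q D μ ℱ β 1 μx μy lam T 𝒯) {i : ℕ} (hi : i < T) :
    Measurable (fun ω => ‖gradX J (𝒯.x (i + 1) ω) (𝒯.y (i + 1) ω)‖) ∧
      Measurable (fun ω => ‖gradY J (𝒯.x (i + 1) ω) (𝒯.y (i + 1) ω)‖) := by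
  have hz : Measurable (𝒯.z (i + 1)) := (h.measurable hQ (i + 1) hi).1.mono (ℱ.le _) le_rfl
  have hg := hL.contDiff_gradient.continuous.measurable.comp hz
  exact ⟨(measurable_fst_joint.comp hg).norm, (measurable_snd_joint.comp hg).norm⟩

/-- The sum of the expected gradient norms, bounded by the initial gaps and the expected momentum
errors. -/
theorem sum_integral_gradNorms_le [IsProbabilityMeasure μ] [IsProbabilityMeasure D]
    (hν : 0 < ν) (hνL : ν ≤ Lf) (ha : 0 < a) (hab : a ≤ b) (hLh : 0 ≤ Lh) (hσ : 0 ≤ σ)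
    (hσh : 0 ≤ σh) (hβ : 0 < β) (hβ1 : β ≤ 1) (hμx : 0 < μx) (hμy : 0 < μy)
    (hμ : μx ≤ √a * μy / (6 * √b * (Lf / ν)))
    (h : Assumptions J Q D μ ℱ ν Lf Lh σ σh a b β μx μy lam T 𝒯) :
    (∀ i < T, Integrable (gradNorms J 𝒯 i) μ) ∧
    ∑ i ∈ Finset.range T, ∫ ω, gradNorms J 𝒯 i ω ∂μ ≤
      √b / μx * startEnvelopeGap μ J 𝒯
      + 9 / 2 * (Lf / ν * b / (√a * μy)) * startGap μ J 𝒯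
      + (2 * (√b / √a) + 9 * (Lf / ν) * (b / a))
        * ∑ i ∈ Finset.range T, ∫ ω, ‖momentumError J 𝒯 (i + 1) ω‖ ∂μ
      + T * (√b * Lf * (1 / 2 + 2 * (Lf / ν)) / a * μx
        + 9 / 4 * (Lf / ν * b * Lf / (a * √a)) * (μx + μy)) := by
  have hρ : ∀ i < T, ∀ᵐ ω ∂μ, ‖𝒯.z (i + 1) ω - 𝒯.z i ω‖ ^ 2 ≤ (μx ^ 2 + μy ^ 2) / a :=
    fun i hi => norm_z_sub_sq_le ha hμx hμy h.run h.scaling h.startClose hi.le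
  have iE : ∀ i ∈ Finset.range T, Integrable (fun ω => ‖momentumError J 𝒯 (i + 1) ω‖) μ :=
    fun i hi => (integral_norm_momentumError_le h.lipschitz hLh hσ hσh hβ hβ1 h.loss h.run
      (by positivity) hρ (i := i + 1) (Finset.mem_range.1 hi)).1
  have hscal : ∀ᵐ ω ∂μ, ∀ i, i < T → DiagBetween a b (scalingDiag lam (𝒯.vx (i + 1) ω)) ∧
      DiagBetween a b (scalingDiag lam (𝒯.vy (i + 1) ω)) :=
    ae_all_iff.2 fun i => by
      by_cases hi : i < T
      · filter_upwards [h.scaling i hi] with ω hω _ using hω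
      · exact Filter.Eventually.of_forall fun ω h => absurd h hi
  have hpath : ∀ᵐ ω ∂μ, ∑ i ∈ Finset.range T, gradNorms J 𝒯 i ω ≤
      √b / μx * (envelope J (𝒯.x 1 ω) - envelopeInf J)
      + 9 / 2 * (Lf / ν * b / (√a * μy)) * (envelope J (𝒯.x 1 ω) - J (col (𝒯.x 1 ω) (𝒯.y 1 ω)))
      + (2 * (√b / √a) + 9 * (Lf / ν) * (b / a))
        * ∑ i ∈ Finset.range T, ‖momentumError J 𝒯 (i + 1) ω‖
      + T * (√b * Lf * (1 / 2 + 2 * (Lf / ν)) / a * μx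
        + 9 / 4 * (Lf / ν * b * Lf / (a * √a)) * (μx + μy)) := by
    filter_upwards [hscal] with ω hω
    exact sum_grad_norm_le h.lipschitz h.pl hν hνL ha hab hμx hμy hμ (T := T)
      (dx := fun i => scalingDiag lam (𝒯.vx (i + 1) ω))
      (dy := fun i => scalingDiag lam (𝒯.vy (i + 1) ω))
      (x := fun i => 𝒯.x (i + 1) ω) (y := fun i => 𝒯.y (i + 1) ω)
      (mx := fun i => 𝒯.mx (i + 1) ω) (my := fun i => 𝒯.my (i + 1) ω) hω
      (fun i hi => h.run.x_update i hi ω) (fun i hi => h.run.y_update i hi ω)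
  have i1 : Integrable (fun ω => √b / μx * (envelope J (𝒯.x 1 ω) - envelopeInf J)) μ :=
    (h.startIntegrable.1.sub (integrable_const _)).const_mul _
  have i2 : Integrable (fun ω => 9 / 2 * (Lf / ν * b / (√a * μy))
      * (envelope J (𝒯.x 1 ω) - J (col (𝒯.x 1 ω) (𝒯.y 1 ω)))) μ :=
    (h.startIntegrable.1.sub h.startIntegrable.2).const_mul _
  have i3 : Integrable (fun ω => (2 * (√b / √a) + 9 * (Lf / ν) * (b / a))
        * ∑ i ∈ Finset.range T, ‖momentumError J 𝒯 (i + 1) ω‖) μ :=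
    (integrable_finsetSum _ iE).const_mul _
  have i12 := i1.add i2
  have i123 := i12.add i3
  have i1234 := i123.add (integrable_const (μ := μ)
    (T * (√b * Lf * (1 / 2 + 2 * (Lf / ν)) / a * μx
        + 9 / 4 * (Lf / ν * b * Lf / (a * √a)) * (μx + μy))))
  have hnn : ∀ i ω, 0 ≤ gradNorms J 𝒯 i ω := fun i ω => by unfold gradNorms; positivity
  -- Integrability is a by-product of the pathwise bound: its right side is integrable and dominates
  -- each nonnegative summand.
  have hint : ∀ i < T, Integrable (gradNorms J 𝒯 i) μ := fun i hi => by
    have hm := measurable_gradNorms h.lipschitz h.loss h.run hi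
    refine i1234.mono' (hm.1.add hm.2).aestronglyMeasurable ?_
    filter_upwards [hpath] with ω hω
    rw [Real.norm_of_nonneg (hnn i ω)]
    exact (Finset.single_le_sum (f := fun i => gradNorms J 𝒯 i ω) (fun j _ => hnn j ω)
      (Finset.mem_range.2 hi)).trans hω
  refine ⟨hint, ?_⟩
  rw [← integral_finsetSum _ fun i hi => hint i (Finset.mem_range.1 hi)]
  refine (integral_mono_ae (integrable_finsetSum _ fun i hi => hint i (Finset.mem_range.1 hi))
    i1234 hpath).trans_eq ?_
  rw [integral_add' i123 (integrable_const _), integral_add' i12 i3, integral_add' i1 i2,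
    integral_const_mul, integral_const_mul, integral_const_mul, integral_finsetSum _ iE,
    integral_sub h.startIntegrable.1 (integrable_const _), startEnvelopeGap, startGap]
  simp only [integral_const, probReal_univ, one_smul]

/-- The explicit bound on the average gradient norm. -/
theorem avgGradNorm_le [IsProbabilityMeasure μ] [IsProbabilityMeasure D]
    (hν : 0 < ν) (hνL : ν ≤ Lf) (ha : 0 < a) (hab : a ≤ b) (hLh : 0 ≤ Lh) (hσ : 0 ≤ σ)
    (hσh : 0 ≤ σh) (hβ : 0 < β) (hβ1 : β ≤ 1) (hμx : 0 < μx) (hμy : 0 < μy)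
    (hμ : μx ≤ √a * μy / (6 * √b * (Lf / ν))) (hT : 1 ≤ T)
    (h : Assumptions J Q D μ ℱ ν Lf Lh σ σh a b β μx μy lam T 𝒯) :
    (∀ i < T, Integrable (gradNorms J 𝒯 i) μ) ∧
    avgGradNorm μ J T 𝒯 ≤
        3 * √b * startEnvelopeGap μ J 𝒯 / (μx * T)
        + 20 * √b * Lf * startDist μ J 𝒯 / (√a * T)
        + 60 * b * (Lf / ν) * startGap μ J 𝒯 / (√a * μy * T)
        + C₁ a b Lf (Lf / ν) * μx + C₂ a b Lf (Lf / ν) * μy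
        + C₃ a b (Lf / ν) * (σ / (β * T) + Lh * (μx ^ 2 + μy ^ 2) / (2 * a * β)
            + √2 * σh * μy / √(β * a) + σ * √β) := by
  have hT0 : (0 : ℝ) < T := by exact_mod_cast hT
  have hb : 0 < b := ha.trans_le hab
  have hsa := Real.sqrt_pos.2 ha
  have hsb := Real.sqrt_pos.2 hb
  have hLf : 0 < Lf := hν.trans_le hνL
  have hκ : 1 ≤ Lf / ν := (one_le_div hν).2 hνL
  have hμxy : μx ≤ μy := by
    refine hμ.trans ?_
    rw [div_le_iff₀ (by positivity)]
    have h1 : √a ≤ √b := Real.sqrt_le_sqrt hab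
    have h2 : √b * 1 ≤ √b * (6 * (Lf / ν)) := by gcongr; linarith
    nlinarith
  obtain ⟨hint, hsum⟩ := sum_integral_gradNorms_le hν hνL ha hab hLh hσ hσh hβ hβ1 hμx hμy hμ h
  refine ⟨hint, ?_⟩
  have hρ : ∀ i < T, ∀ᵐ ω ∂μ, ‖𝒯.z (i + 1) ω - 𝒯.z i ω‖ ^ 2 ≤ (μx ^ 2 + μy ^ 2) / a :=
    fun i hi => norm_z_sub_sq_le ha hμx hμy h.run h.scaling h.startClose hi.le
  have herr := sum_integral_norm_momentumError_le h.lipschitz hLh hσ hσh hβ hβ1 h.loss h.run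
    (by positivity) hρ
  have hG := startEnvelopeGap_nonneg h.pl h.startIntegrable
  have hg := startGap_nonneg (μ := μ) (𝒯 := 𝒯) h.pl
  have hd := startDist_nonneg (μ := μ) (J := J) (𝒯 := 𝒯)
  rw [avgGradNorm]
  generalize startEnvelopeGap μ J 𝒯 = G at *
  generalize startGap μ J 𝒯 = g at *
  generalize startDist μ J 𝒯 = d at *
  generalize Lf / ν = κ at *
  generalize ∑ i ∈ Finset.range T, ∫ ω, gradNorms J 𝒯 i ω ∂μ = S at *
  generalize ∑ i ∈ Finset.range T, ∫ ω, ‖momentumError J 𝒯 (i + 1) ω‖ ∂μ = E at *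
  generalize (T : ℝ) = t at *
  have hκ0 : 0 < κ := by linarith
  set R := σ / (β * t) + Lh * (μx ^ 2 + μy ^ 2) / (2 * a * β) + √2 * σh * μy / √(β * a) + σ * √β
    with hR
  have hR0 : 0 ≤ R := by positivity
  have hE : E / t ≤ R := by
    -- By μx ≤ μy the squared displacement is at most 2μy²/a, which is the source of √2.
    have hsq : σh * √((μx ^ 2 + μy ^ 2) / a / β) ≤ √2 * σh * μy / √(β * a) := by
      have h1 : √((μx ^ 2 + μy ^ 2) / a / β) ≤ √2 * μy / √(β * a) := by
        rw [Real.sqrt_le_left (by positivity), div_pow, mul_pow, Real.sq_sqrt (by norm_num),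
          Real.sq_sqrt (by positivity), div_div, mul_comm a β]
        refine div_le_div_of_nonneg_right ?_ (by positivity)
        nlinarith
      calc _ ≤ σh * (√2 * μy / √(β * a)) := by gcongr
        _ = _ := by ring
    have h1 : E / t ≤ (σ / β + t * (Lh * ((μx ^ 2 + μy ^ 2) / a) / (2 * β)
        + σh * √((μx ^ 2 + μy ^ 2) / a / β) + σ * √β)) / t := by gcongr
    have h2 : (σ / β + t * (Lh * ((μx ^ 2 + μy ^ 2) / a) / (2 * β)
        + σh * √((μx ^ 2 + μy ^ 2) / a / β) + σ * √β)) / t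
        = σ / (β * t) + Lh * (μx ^ 2 + μy ^ 2) / (2 * a * β)
          + σh * √((μx ^ 2 + μy ^ 2) / a / β) + σ * √β := by
      field_simp
      ring
    linarith
  have hS : 1 / t * S ≤ √b * G / (μx * t) + 9 / 2 * (b * κ * g / (√a * μy * t))
      + (2 * (√b / √a) + 9 * (κ * b / a)) * (E / t)
      + ((√b * Lf / a / 2 + 2 * (√b * Lf * κ / a)) * μx
        + 9 / 4 * (b * Lf * κ / (a * √a)) * (μx + μy)) := by
    have := mul_le_mul_of_nonneg_left hsum (by positivity : 0 ≤ 1 / t)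
    refine this.trans_eq ?_
    field_simp
  have hC1 : C₁ a b Lf κ = 13 / 2 * (√b * Lf / a) + 43 / 4 * (√b * Lf * κ / a)
      + 160 * (b * Lf * κ / (a * √a)) := by
    rw [C₁, smoothL]; ring
  have hC2 : C₂ a b Lf κ = 30 * (b * Lf * κ / (a * √a)) + 20 * (√b * Lf / a) := by rw [C₂]; ring
  have hC3 : C₃ a b κ = 160 * (κ * b / a) + 8 * (√b / √a) := by rw [C₃]; ring
  rw [hC1, hC2, hC3]
  have n1 : 0 ≤ √b * G / (μx * t) := by positivity
  have n2 : 0 ≤ b * κ * g / (√a * μy * t) := by positivity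
  -- The bound `hS` contains no distance term and has smaller coefficients than the stated ones; the
  -- distance term enters only as a nonnegative summand.
  have n3 : 0 ≤ 20 * √b * Lf * d / (√a * t) := by positivity
  have e1 : 3 * √b * G / (μx * t) = 3 * (√b * G / (μx * t)) := by ring
  have e2 : 60 * b * κ * g / (√a * μy * t) = 60 * (b * κ * g / (√a * μy * t)) := by ring
  have hER : (2 * (√b / √a) + 9 * (κ * b / a)) * (E / t)
      ≤ (160 * (κ * b / a) + 8 * (√b / √a)) * R := by
    have p1 : 0 ≤ √b / √a := by positivity
    have p2 : 0 ≤ κ * b / a := by positivity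
    exact (mul_le_mul_of_nonneg_left hE (by positivity)).trans
      (mul_le_mul_of_nonneg_right (by linarith) hR0)
  have hK : (√b * Lf / a / 2 + 2 * (√b * Lf * κ / a)) * μx
        + 9 / 4 * (b * Lf * κ / (a * √a)) * (μx + μy)
      ≤ (13 / 2 * (√b * Lf / a) + 43 / 4 * (√b * Lf * κ / a)
        + 160 * (b * Lf * κ / (a * √a))) * μx
        + (30 * (b * Lf * κ / (a * √a)) + 20 * (√b * Lf / a)) * μy := by
    have q1 : 0 ≤ √b * Lf / a * μx := by positivity
    have q2 : 0 ≤ √b * Lf * κ / a * μx := by positivity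
    have q3 : 0 ≤ b * Lf * κ / (a * √a) * μx := by positivity
    have q4 : 0 ≤ b * Lf * κ / (a * √a) * μy := by positivity
    have q5 : 0 ≤ √b * Lf / a * μy := by positivity
    linarith
  linarith

end ExplicitBound

/-! ### From the explicit bound to the order κ/u. -/

section Tuning

/-- The constant is affine in κ with nonnegative intercept. This and its two companions confine κ to
a single linear factor in the rate. -/
theorem C₁_le {a b Lf κ : ℝ} (ha : 0 < a) (hb : 0 < b) (hLf : 0 < Lf) (hκ : 1 ≤ κ) :
    C₁ a b Lf κ ≤ κ * C₁ a b Lf 1 := by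
  have h : κ * C₁ a b Lf 1 - C₁ a b Lf κ = (κ - 1) * (5 * √b * Lf / a + 3 * √b * Lf / (2 * a)) := by
    simp only [C₁, smoothL]; ring
  have : 0 ≤ (κ - 1) * (5 * √b * Lf / a + 3 * √b * Lf / (2 * a)) :=
    mul_nonneg (by linarith) (by positivity)
  linarith

theorem C₂_le {a b Lf κ : ℝ} (ha : 0 < a) (hb : 0 < b) (hLf : 0 < Lf) (hκ : 1 ≤ κ) :
    C₂ a b Lf κ ≤ κ * C₂ a b Lf 1 := by
  have h : κ * C₂ a b Lf 1 - C₂ a b Lf κ = (κ - 1) * (20 * √b * Lf / a) := by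
    simp only [C₂]; ring
  have : 0 ≤ (κ - 1) * (20 * √b * Lf / a) := mul_nonneg (by linarith) (by positivity)
  linarith

theorem C₃_le {a b κ : ℝ} (hκ : 1 ≤ κ) : C₃ a b κ ≤ κ * C₃ a b 1 := by
  have h : κ * C₃ a b 1 - C₃ a b κ = (κ - 1) * (8 * √b / √a) := by
    simp only [C₃]; ring
  have : 0 ≤ (κ - 1) * (8 * √b / √a) := mul_nonneg (by linarith) (by positivity)
  linarith

theorem C₁_pos {a b Lf κ : ℝ} (ha : 0 < a) (hb : 0 < b) (hLf : 0 < Lf) (hκ : 0 < κ) :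
    0 < C₁ a b Lf κ := by
  unfold C₁ smoothL; positivity

theorem C₂_pos {a b Lf κ : ℝ} (ha : 0 < a) (hb : 0 < b) (hLf : 0 < Lf) (hκ : 0 < κ) :
    0 < C₂ a b Lf κ := by
  unfold C₂; positivity

theorem C₃_pos {a b κ : ℝ} (ha : 0 < a) (hb : 0 < b) (hκ : 0 < κ) : 0 < C₃ a b κ := by
  unfold C₃; positivity

theorem C₃_order {a b κ : ℝ} (ha : 0 < a) (hab : a ≤ b) (hκ : 1 ≤ κ) :
    C₃ a b κ ≤ 168 * (κ * b / a) := by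
  have hsa := Real.sqrt_pos.2 ha
  have hr : 1 ≤ √b / √a := (one_le_div hsa).2 (Real.sqrt_le_sqrt hab)
  have hr2 : (√b / √a) ^ 2 = b / a := by
    rw [div_pow, Real.sq_sqrt ha.le, Real.sq_sqrt (ha.le.trans hab)]
  have h1 : √b / √a ≤ b / a := by nlinarith
  have h2 : b / a ≤ κ * (b / a) := le_mul_of_one_le_left (div_nonneg (ha.le.trans hab) ha.le) hκ
  have h3 : C₃ a b κ = 160 * (κ * (b / a)) + 8 * (√b / √a) := by rw [C₃]; ring
  rw [h3, mul_div_assoc]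
  linarith

/-- Bounds the reciprocal of a tuned parameter without asking which branch of the minimum is active.
-/
theorem one_div_min_le {x y : ℝ} (hx : 0 < x) (hy : 0 < y) : 1 / min x y ≤ 1 / x + 1 / y := by
  have h1 : 0 < 1 / x := by positivity
  have h2 : 0 < 1 / y := by positivity
  rcases min_choice x y with h | h <;> rw [h] <;> linarith

/-- The constant of the convergence rate, in terms of bounds on the step sizes. -/
noncomputable def rateConst (a b Lf Lh σ σh δ p A Bx By Bβ B c : ℝ) : ℝ :=
  3 * √b * p * Bx + 20 * √b / √a * c + 60 * b * δ * By / √a + C₁ a b Lf 1 * A + C₂ a b Lf 1 * A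
    + C₃ a b 1 * (σ * Bβ + Lh * A ^ 2 * Bβ / a + √2 * σh * A * √Bβ / √a + σ * √B)

/-- The explicit bound is of order `κ / u`, `u = T^{1/3}`, if the step sizes are of order `u⁻²`. -/
theorem explicit_bound_le_rate {a b Lf Lh σ σh κ β μx μy G g d t u δ p A Bx By Bβ B c : ℝ}
    (ha : 0 < a) (hb : 0 < b) (hLf : 0 < Lf) (hLh : 0 ≤ Lh) (hσ : 0 ≤ σ) (hσh : 0 ≤ σh)
    (hκ : 1 ≤ κ) (hβ : 0 < β) (hμx : 0 < μx) (hμy : 0 < μy) (hu : 1 ≤ u) (ht : t = u ^ 3)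
    (hA : 0 ≤ A) (hBβ : 0 ≤ Bβ) (hB : 0 ≤ B) (hp : 0 ≤ p) (hδ : 0 ≤ δ)
    (hμxy : μx ≤ μy) (hμyA : μy ≤ A / u ^ 2) (hx : 1 / μx ≤ Bx * κ * u ^ 2)
    (hy : 1 / μy ≤ By * u ^ 2) (hβB : 1 / β ≤ Bβ * u ^ 2) (hβ' : β ≤ B / u ^ 2)
    (hG : G ≤ p) (hg : g ≤ δ) (hd : Lf * d ≤ c * κ) (hc : 0 ≤ c) :
    3 * √b * G / (μx * t) + 20 * √b * Lf * d / (√a * t) + 60 * b * κ * g / (√a * μy * t)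
        + C₁ a b Lf κ * μx + C₂ a b Lf κ * μy
        + C₃ a b κ * (σ / (β * t) + Lh * (μx ^ 2 + μy ^ 2) / (2 * a * β)
            + √2 * σh * μy / √(β * a) + σ * √β)
      ≤ rateConst a b Lf Lh σ σh δ p A Bx By Bβ B c * (κ / u) := by
  have hu0 : 0 < u := by linarith
  have hκ0 : 0 < κ := by linarith
  have hsa := Real.sqrt_pos.2 ha
  have hsb := Real.sqrt_pos.2 hb
  have hu2 : u ≤ u ^ 2 := by nlinarith
  have hAu : A / u ^ 2 ≤ A / u := div_le_div_of_nonneg_left hA hu0 hu2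
  -- Here 1/μx is of order κu² and t = u³, leaving κ/u. In `t3` the κ comes from the coefficient,
  -- and in `t2` from the bound on the distance.
  have t1 : 3 * √b * G / (μx * t) ≤ 3 * √b * p * Bx * (κ / u) := by
    calc 3 * √b * G / (μx * t) ≤ 3 * √b * p / (μx * t) := by
          have : 0 < t := by rw [ht]; positivity
          gcongr
      _ = 3 * √b * p / u ^ 3 * (1 / μx) := by rw [ht]; field_simp
      _ ≤ 3 * √b * p / u ^ 3 * (Bx * κ * u ^ 2) := by gcongr
      _ = _ := by field_simp
  have t2 : 20 * √b * Lf * d / (√a * t) ≤ 20 * √b / √a * c * (κ / u) := by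
    calc 20 * √b * Lf * d / (√a * t) = 20 * √b / √a * (Lf * d) / u ^ 3 := by rw [ht]; field_simp
      _ ≤ 20 * √b / √a * (c * κ) / u ^ 3 := by gcongr
      _ ≤ 20 * √b / √a * (c * κ) / u := by
          refine div_le_div_of_nonneg_left (by positivity) hu0 ?_
          nlinarith
      _ = _ := by ring
  have t3 : 60 * b * κ * g / (√a * μy * t) ≤ 60 * b * δ * By / √a * (κ / u) := by
    calc 60 * b * κ * g / (√a * μy * t) ≤ 60 * b * κ * δ / (√a * μy * t) := by
          have : 0 < t := by rw [ht]; positivity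
          gcongr
      _ = 60 * b * κ * δ / (√a * u ^ 3) * (1 / μy) := by rw [ht]; field_simp
      _ ≤ 60 * b * κ * δ / (√a * u ^ 3) * (By * u ^ 2) := by gcongr
      _ = _ := by field_simp
  have t4 : C₁ a b Lf κ * μx ≤ C₁ a b Lf 1 * A * (κ / u) := by
    have := C₁_pos ha hb hLf one_pos
    calc C₁ a b Lf κ * μx ≤ κ * C₁ a b Lf 1 * (A / u) :=
          mul_le_mul (C₁_le ha hb hLf hκ) (by linarith) hμx.le (by positivity)
      _ = _ := by ring
  have t5 : C₂ a b Lf κ * μy ≤ C₂ a b Lf 1 * A * (κ / u) := by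
    have := C₂_pos ha hb hLf one_pos
    calc C₂ a b Lf κ * μy ≤ κ * C₂ a b Lf 1 * (A / u) :=
          mul_le_mul (C₂_le ha hb hLf hκ) (by linarith) hμy.le (by positivity)
      _ = _ := by ring
  have r1 : σ / (β * t) ≤ σ * Bβ / u := by
    calc σ / (β * t) = σ / u ^ 3 * (1 / β) := by rw [ht]; field_simp
      _ ≤ σ / u ^ 3 * (Bβ * u ^ 2) := by gcongr
      _ = _ := by field_simp
  -- This term is in fact of order u⁻⁴·u² = u⁻², and one power of u is given away.
  have r2 : Lh * (μx ^ 2 + μy ^ 2) / (2 * a * β) ≤ Lh * A ^ 2 * Bβ / a / u := by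
    have hsq : μx ^ 2 + μy ^ 2 ≤ 2 * (A / u ^ 2) ^ 2 := by
      have h1 := pow_le_pow_left₀ hμx.le (hμxy.trans hμyA) 2
      have h2 := pow_le_pow_left₀ hμy.le hμyA 2
      linarith
    calc Lh * (μx ^ 2 + μy ^ 2) / (2 * a * β)
        = Lh * (μx ^ 2 + μy ^ 2) / (2 * a) * (1 / β) := by field_simp
      _ ≤ Lh * (2 * (A / u ^ 2) ^ 2) / (2 * a) * (Bβ * u ^ 2) := by gcongr
      _ = Lh * A ^ 2 * Bβ / a / u ^ 2 := by field_simp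
      _ ≤ _ := div_le_div_of_nonneg_left (by positivity) hu0 hu2
  have r3 : √2 * σh * μy / √(β * a) ≤ √2 * σh * A * √Bβ / √a / u := by
    have hs : 1 / √β ≤ √Bβ * u := by
      have h1 := Real.sqrt_le_sqrt hβB
      rwa [Real.sqrt_mul hBβ, Real.sqrt_sq hu0.le, Real.sqrt_div zero_le_one, Real.sqrt_one] at h1
    have hsβ := Real.sqrt_pos.2 hβ
    calc √2 * σh * μy / √(β * a) = √2 * σh * μy / √a * (1 / √β) := by
          rw [Real.sqrt_mul hβ.le]; field_simp
      _ ≤ √2 * σh * (A / u ^ 2) / √a * (√Bβ * u) := by gcongr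
      _ = _ := by field_simp
  have r4 : σ * √β ≤ σ * √B / u := by
    have h1 := Real.sqrt_le_sqrt hβ'
    rw [Real.sqrt_div hB, Real.sqrt_sq hu0.le] at h1
    rw [mul_div_assoc]
    gcongr
  have t6 : C₃ a b κ * (σ / (β * t) + Lh * (μx ^ 2 + μy ^ 2) / (2 * a * β)
            + √2 * σh * μy / √(β * a) + σ * √β)
      ≤ C₃ a b 1 * (σ * Bβ + Lh * A ^ 2 * Bβ / a + √2 * σh * A * √Bβ / √a + σ * √B) * (κ / u) := by
    have hC := C₃_pos ha hb one_pos
    have ht0 : 0 < t := by rw [ht]; positivity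
    calc _ ≤ κ * C₃ a b 1 * (σ * Bβ / u + Lh * A ^ 2 * Bβ / a / u
            + √2 * σh * A * √Bβ / √a / u + σ * √B / u) :=
          mul_le_mul (C₃_le hκ) (by linarith) (by positivity) (by positivity)
      _ = _ := by ring
  rw [rateConst]
  linarith

end Tuning

/-! ### The initial distance to the maximizers. -/

section StartDist

variable {M₁ M₂ : ℕ} {Ω Ξ : Type*} [MeasurableSpace Ω] {J : Joint M₁ M₂ → ℝ} {μ : Measure Ω}
  {ν Lf Lh : ℝ} {𝒯 : Trajectory M₁ M₂ Ω Ξ}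

/-- Quadratic growth bounds ν r² by 8 times the gap, and expanding ν(κ - r)² ≥ 0 with νκ = Lf trades
Lf r for it. The distance is thus controlled by the expected gap, with growth only linear in κ. -/
theorem startDist_le [IsProbabilityMeasure μ] (hL : LipschitzCost J Lf Lh) (hP : PLCost J ν)
    (hν : 0 < ν) (hνL : ν ≤ Lf) (hI : StartIntegrable μ J 𝒯) :
    Lf * startDist μ J 𝒯 ≤ Lf * (Lf / ν) / 2 + 4 * startGap μ J 𝒯 := by
  have hLf : 0 < Lf := hν.trans_le hνL
  have hpt : ∀ ω, Lf * Metric.infDist (𝒯.y 1 ω) (maximizers J (𝒯.x 1 ω)) ≤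
      Lf * (Lf / ν) / 2 + 4 * (envelope J (𝒯.x 1 ω) - J (col (𝒯.x 1 ω) (𝒯.y 1 ω))) := fun ω => by
    obtain ⟨y', hy', hd⟩ := exists_maximizer_near hL hP hν (𝒯.x 1 ω) (𝒯.y 1 ω)
    have h1 := Metric.infDist_le_dist_of_mem (x := 𝒯.y 1 ω) hy'
    rw [dist_comm, dist_eq_norm] at h1
    have h2 := mul_le_mul_of_nonneg_left h1 hLf.le
    have h3 : 0 ≤ ν * (Lf / ν - ‖y' - 𝒯.y 1 ω‖) ^ 2 := by positivity
    have h4 : ν * (Lf / ν - ‖y' - 𝒯.y 1 ω‖) ^ 2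
        = Lf * (Lf / ν) - 2 * (Lf * ‖y' - 𝒯.y 1 ω‖) + ν * ‖y' - 𝒯.y 1 ω‖ ^ 2 := by
      field_simp
      ring
    linarith
  have hi : Integrable (fun ω => 4 * (envelope J (𝒯.x 1 ω) - J (col (𝒯.x 1 ω) (𝒯.y 1 ω)))) μ :=
    (hI.1.sub hI.2).const_mul 4
  -- Only the dominating side has to be integrable, so nothing need be known about the measurability
  -- of the distance to the random set of maximizers.
  have h5 := integral_mono_of_nonneg (μ := μ)
    (Filter.Eventually.of_forall fun ω => mul_nonneg hLf.le Metric.infDist_nonneg)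
    ((integrable_const (Lf * (Lf / ν) / 2)).add hi) (Filter.Eventually.of_forall hpt)
  rw [integral_const_mul, integral_add' (integrable_const _) hi, integral_const_mul] at h5
  simp only [integral_const, probReal_univ, one_smul] at h5
  exact h5

end StartDist

/-! ### The uniformly chosen output. -/

section Output

variable {Ω : Type*} [MeasurableSpace Ω] {μ : Measure Ω} [IsProbabilityMeasure μ] {T : ℕ}

/-- Expectation of `f τ` for an independent uniform time `τ`. -/
theorem integral_uniform_time (hT : 1 ≤ T) {f : ℕ → Ω → ℝ} (hf : ∀ i < T, Measurable (f i))
    (hint : ∀ i < T, Integrable (f i) μ) :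
    Integrable (fun q : Ω × Fin T => f q.2 q.1) (μ.prod (uniformOn (Set.univ : Set (Fin T)))) ∧
      ∫ q : Ω × Fin T, f q.2 q.1 ∂(μ.prod (uniformOn (Set.univ : Set (Fin T))))
        = 1 / (T : ℝ) * ∑ i ∈ Finset.range T, ∫ ω, f i ω ∂μ := by
  have : Nonempty (Fin T) := ⟨⟨0, hT⟩⟩
  have : IsProbabilityMeasure (uniformOn (Set.univ : Set (Fin T))) :=
    isProbabilityMeasure_uniformOn Set.finite_univ Set.univ_nonempty
  have hm : Measurable fun q : Ω × Fin T => f q.2 q.1 :=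
    measurable_from_prod_countable_left fun i => hf i i.2
  have hi : Integrable (fun q : Ω × Fin T => f q.2 q.1)
      (μ.prod (uniformOn (Set.univ : Set (Fin T)))) := by
    rw [integrable_prod_iff' hm.aestronglyMeasurable]
    exact ⟨Filter.Eventually.of_forall fun i => hint i i.2, Integrable.of_finite⟩
  refine ⟨hi, ?_⟩
  rw [integral_prod_symm _ hi, integral_fintype Integrable.of_finite, Finset.mul_sum,
    ← Fin.sum_univ_eq_sum_range (fun i => 1 / (T : ℝ) * ∫ ω, f i ω ∂μ)]
  refine Finset.sum_congr rfl fun i _ => ?_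
  have : (uniformOn (Set.univ : Set (Fin T))).real {i} = 1 / T := by
    rw [measureReal_def, uniformOn_univ]
    simp
  rw [this, smul_eq_mul]

/-- Averaging over the independent uniform time turns an expectation at the output into a time
average, and each partial gradient norm is at most the sum of the two. -/
theorem outputStationary_of_avgGradNorm_le {M₁ M₂ : ℕ} {Ξ : Type*} {J : Joint M₁ M₂ → ℝ}
    {𝒯 : Trajectory M₁ M₂ Ω Ξ} {ε : ℝ} (hT : 1 ≤ T)
    (hx : ∀ i < T, Measurable fun ω => ‖gradX J (𝒯.x (i + 1) ω) (𝒯.y (i + 1) ω)‖)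
    (hy : ∀ i < T, Measurable fun ω => ‖gradY J (𝒯.x (i + 1) ω) (𝒯.y (i + 1) ω)‖)
    (hint : ∀ i < T, Integrable (gradNorms J 𝒯 i) μ) (hε : avgGradNorm μ J T 𝒯 ≤ ε) :
    OutputStationary μ J T 𝒯 ε := by
  have hpart : ∀ f : ℕ → Ω → ℝ, (∀ i < T, Measurable (f i)) → (∀ i ω, 0 ≤ f i ω) →
      (∀ i ω, f i ω ≤ gradNorms J 𝒯 i ω) →
      Integrable (fun q : Ω × Fin T => f q.2 q.1) (μ.prod (uniformOn (Set.univ : Set (Fin T)))) ∧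
        ∫ q : Ω × Fin T, f q.2 q.1 ∂(μ.prod (uniformOn (Set.univ : Set (Fin T)))) ≤ ε := by
    intro f hf hf0 hle
    have hfi : ∀ i < T, Integrable (f i) μ := fun i hi =>
      (hint i hi).mono' (hf i hi).aestronglyMeasurable (Filter.Eventually.of_forall fun ω => by
        rw [Real.norm_of_nonneg (hf0 i ω)]; exact hle i ω)
    obtain ⟨h1, h2⟩ := integral_uniform_time hT hf hfi
    refine ⟨h1, ?_⟩
    rw [h2]
    refine le_trans ?_ hε
    rw [avgGradNorm]
    refine mul_le_mul_of_nonneg_left (Finset.sum_le_sum fun i hi => ?_) (by positivity)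
    have hi := Finset.mem_range.1 hi
    exact integral_mono (hfi i hi) (hint i hi) (hle i)
  exact ⟨hpart (fun i ω => ‖gradX J (𝒯.x (i + 1) ω) (𝒯.y (i + 1) ω)‖) hx
      (fun _ _ => norm_nonneg _) (fun _ _ => le_add_of_nonneg_right (norm_nonneg _)),
    hpart (fun i ω => ‖gradY J (𝒯.x (i + 1) ω) (𝒯.y (i + 1) ω)‖) hy
      (fun _ _ => norm_nonneg _) (fun _ _ => le_add_of_nonneg_left (norm_nonneg _))⟩

end Output

/-! ### Orders of the tuned parameters, with u = T^{1/3}. -/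

section TunedParameters

variable {a b σ σh δ p κ u : ℝ} {T : ℕ}

theorem rpow_two_thirds (T : ℕ) : (T : ℝ) ^ (2 / 3 : ℝ) = ((T : ℝ) ^ (1 / 3 : ℝ)) ^ 2 := by
  rw [← Real.rpow_natCast, ← Real.rpow_mul (Nat.cast_nonneg T)]
  norm_num

theorem cube_rpow_one_third (T : ℕ) : (T : ℝ) = ((T : ℝ) ^ (1 / 3 : ℝ)) ^ 3 := by
  rw [← Real.rpow_natCast, ← Real.rpow_mul (Nat.cast_nonneg T)]
  norm_num

theorem one_le_rpow_one_third (hT : 1 ≤ T) : 1 ≤ (T : ℝ) ^ (1 / 3 : ℝ) :=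
  Real.one_le_rpow (by exact_mod_cast hT) (by norm_num)

/-- Two-sided order u⁻². The upper bound uses the first entry of the minimum; each entry contributes
one summand to the reciprocal bound, the entry 1 being absorbed by u² ≥ 1. -/
theorem betaTuned_bounds (ha : 0 < a) (hb : 0 < b) (hσ : 0 < σ) (hT : 1 ≤ T)
    (hu : u = (T : ℝ) ^ (1 / 3 : ℝ)) :
    0 < betaTuned a b σ T ∧ betaTuned a b σ T ≤ 1 ∧ betaTuned a b σ T ≤ b * σ / a / u ^ 2 ∧
      1 / betaTuned a b σ T ≤ (a / (b * σ) + σ ^ 2 * b ^ 2 / a ^ 2 + 1) * u ^ 2 := by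
  have hu1 : 1 ≤ u := hu ▸ one_le_rpow_one_third hT
  have hu0 : 0 < u := by linarith
  rw [betaTuned, rpow_two_thirds, ← hu]
  have h1 : 0 < b * σ / (a * u ^ 2) := by positivity
  have h2 : 0 < a ^ 2 / (σ ^ 2 * b ^ 2 * u ^ 2) := by positivity
  have h3 : 0 < min (a ^ 2 / (σ ^ 2 * b ^ 2 * u ^ 2)) 1 := lt_min h2 one_pos
  refine ⟨lt_min h1 h3, (min_le_right _ _).trans (min_le_right _ _), ?_, ?_⟩
  · rw [div_div]
    exact min_le_left _ _
  · refine (one_div_min_le h1 h3).trans ?_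
    have h4 := one_div_min_le h2 one_pos
    have e1 : 1 / (b * σ / (a * u ^ 2)) = a / (b * σ) * u ^ 2 := by field_simp
    have e2 : 1 / (a ^ 2 / (σ ^ 2 * b ^ 2 * u ^ 2)) = σ ^ 2 * b ^ 2 / a ^ 2 * u ^ 2 := by field_simp
    rw [e2] at h4
    rw [e1]
    nlinarith

theorem muYTuned_bounds (ha : 0 < a) (hb : 0 < b) (hσ : 0 < σ) (hσh : 0 < σh) (hδ : 0 < δ)
    (hT : 1 ≤ T) (hu : u = (T : ℝ) ^ (1 / 3 : ℝ)) :
    0 < muYTuned a b σ σh δ T ∧ muYTuned a b σ σh δ T ≤ √σ * a / (σh * √b) / u ^ 2 ∧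
      1 / muYTuned a b σ σh δ T ≤ (√a / (b * δ) + σh * √b / (√σ * a)) * u ^ 2 := by
  have hu1 : 1 ≤ u := hu ▸ one_le_rpow_one_third hT
  have hu0 : 0 < u := by linarith
  have hsa := Real.sqrt_pos.2 ha
  have hsb := Real.sqrt_pos.2 hb
  have hsσ := Real.sqrt_pos.2 hσ
  rw [muYTuned, rpow_two_thirds, ← hu]
  have h1 : 0 < b * δ / √a := by positivity
  have h2 : 0 < √σ * a / (σh * √b * u ^ 2) := by positivity
  refine ⟨lt_min h1 h2, ?_, (one_div_min_le h1 h2).trans ?_⟩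
  · rw [div_div]
    exact min_le_right _ _
  · have e1 : 1 / (b * δ / √a) = √a / (b * δ) := by field_simp
    have e2 : 1 / (√σ * a / (σh * √b * u ^ 2)) = σh * √b / (√σ * a) * u ^ 2 := by field_simp
    have h3 : √a / (b * δ) ≤ √a / (b * δ) * u ^ 2 :=
      le_mul_of_one_le_right (by positivity) (one_le_pow₀ hu1)
    rw [e1, e2, add_mul]
    linarith

theorem muXTuned_bounds (ha : 0 < a) (hb : 0 < b) (hσ : 0 < σ) (hσh : 0 < σh) (hδ : 0 < δ)
    (hp : 0 < p) (hκ : 1 ≤ κ) (hT : 1 ≤ T) (hu : u = (T : ℝ) ^ (1 / 3 : ℝ)) :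
    0 < muXTuned a b σ σh δ p κ T ∧
      muXTuned a b σ σh δ p κ T ≤ √a * muYTuned a b σ σh δ T / (6 * √b * κ) ∧
      1 / muXTuned a b σ σh δ p κ T ≤
        (6 * √b / √a * (√a / (b * δ) + σh * √b / (√σ * a)) + 1 / (√b * p)) * κ * u ^ 2 := by
  obtain ⟨hy0, -, hy⟩ := muYTuned_bounds ha hb hσ hσh hδ hT hu
  have hu1 : 1 ≤ u := hu ▸ one_le_rpow_one_third hT
  have hu0 : 0 < u := by linarith
  have hκ0 : 0 < κ := by linarith
  have hsa := Real.sqrt_pos.2 ha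
  have hsb := Real.sqrt_pos.2 hb
  rw [muXTuned, rpow_two_thirds, ← hu]
  generalize muYTuned a b σ σh δ T = μy at *
  generalize √a / (b * δ) + σh * √b / (√σ * a) = B at *
  have h1 : 0 < √a / (6 * √b * κ) * μy := by positivity
  have h2 : 0 < √b * p / u ^ 2 := by positivity
  refine ⟨lt_min h1 h2, ?_, (one_div_min_le h1 h2).trans ?_⟩
  · refine (min_le_left _ _).trans_eq ?_
    ring
  · have e1 : 1 / (√a / (6 * √b * κ) * μy) = 6 * √b / √a * κ * (1 / μy) := by field_simp
    have e2 : 1 / (√b * p / u ^ 2) = 1 / (√b * p) * u ^ 2 := by field_simp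
    have h3 : 6 * √b / √a * κ * (1 / μy) ≤ 6 * √b / √a * κ * (B * u ^ 2) := by gcongr
    have h4 : 1 / (√b * p) * u ^ 2 ≤ 1 / (√b * p) * u ^ 2 * κ :=
      le_mul_of_one_le_right (by positivity) hκ
    rw [e1, e2]
    linarith

end TunedParameters

/-! ### The convergence rate for the tuned parameters. -/

section Rate

/-- The constant of the convergence rate for the tuned parameters. -/
noncomputable def tunedRateConst (a b Lf Lh σ σh δ p : ℝ) : ℝ :=
  rateConst a b Lf Lh σ σh δ p (√σ * a / (σh * √b))
    (6 * √b / √a * (√a / (b * δ) + σh * √b / (√σ * a)) + 1 / (√b * p))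
    (√a / (b * δ) + σh * √b / (√σ * a)) (a / (b * σ) + σ ^ 2 * b ^ 2 / a ^ 2 + 1) (b * σ / a)
    (Lf / 2 + 4 * δ)

variable {a b Lf Lh σ σh δ p : ℝ}

theorem tunedRateConst_pos (ha : 0 < a) (hb : 0 < b) (hLh : 0 ≤ Lh) (hLf : 0 < Lf) (hσ : 0 < σ)
    (hσh : 0 < σh) (hδ : 0 < δ) (hp : 0 < p) : 0 < tunedRateConst a b Lf Lh σ σh δ p := by
  have h1 := C₁_pos ha hb hLf one_pos
  have h2 := C₂_pos ha hb hLf one_pos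
  have h3 := C₃_pos ha hb one_pos
  unfold tunedRateConst rateConst
  positivity

/-- The convergence rate for the tuned parameters. -/
theorem avgGradNorm_tuned_le {M₁ M₂ : ℕ} {Ω Ξ : Type*} [mΩ : MeasurableSpace Ω]
    [MeasurableSpace Ξ] {D : Measure Ξ} [IsProbabilityMeasure D] {μ : Measure Ω}
    [IsProbabilityMeasure μ] {ℱ : Filtration ℕ mΩ} {J : Joint M₁ M₂ → ℝ} {Q : Joint M₁ M₂ → Ξ → ℝ}
    {ν lam : ℝ} {T : ℕ} {𝒯 : Trajectory M₁ M₂ Ω Ξ} (ha : 0 < a) (hab : a ≤ b) (hLh : 0 ≤ Lh)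
    (hσ : 0 < σ) (hσh : 0 < σh) (hδ : 0 < δ) (hp : 0 < p) (hν : 0 < ν) (hνL : ν ≤ Lf) (hT : 1 ≤ T)
    (h : Assumptions J Q D μ ℱ ν Lf Lh σ σh a b (betaTuned a b σ T)
      (muXTuned a b σ σh δ p (Lf / ν) T) (muYTuned a b σ σh δ T) lam T 𝒯)
    (hg : startGap μ J 𝒯 ≤ δ) (hG : startEnvelopeGap μ J 𝒯 ≤ p) :
    (∀ i < T, Integrable (gradNorms J 𝒯 i) μ) ∧
      avgGradNorm μ J T 𝒯 ≤
        tunedRateConst a b Lf Lh σ σh δ p * (Lf / ν / (T : ℝ) ^ (1 / 3 : ℝ)) := by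
  have hb : 0 < b := ha.trans_le hab
  have hLf : 0 < Lf := hν.trans_le hνL
  have hκ : 1 ≤ Lf / ν := (one_le_div hν).2 hνL
  obtain ⟨hβ0, hβ1, hβB, hβi⟩ := betaTuned_bounds ha hb hσ hT rfl
  obtain ⟨hy0, hyA, hyi⟩ := muYTuned_bounds ha hb hσ hσh hδ hT rfl
  obtain ⟨hx0, hxy, hxi⟩ := muXTuned_bounds ha hb hσ hσh hδ hp hκ hT rfl
  obtain ⟨hint, havg⟩ := avgGradNorm_le hν hνL ha hab hLh hσ.le hσh.le hβ0 hβ1 hx0 hy0 hxy hT h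
  refine ⟨hint, havg.trans ?_⟩
  have hd : Lf * startDist μ J 𝒯 ≤ (Lf / 2 + 4 * δ) * (Lf / ν) := by
    have h1 := startDist_le h.lipschitz h.pl hν hνL h.startIntegrable
    have h2 : δ ≤ δ * (Lf / ν) := le_mul_of_one_le_right hδ.le hκ
    linarith
  have hxy' : muXTuned a b σ σh δ p (Lf / ν) T ≤ muYTuned a b σ σh δ T := by
    refine hxy.trans ?_
    have hsa := Real.sqrt_pos.2 ha
    have hsb := Real.sqrt_pos.2 hb
    rw [div_le_iff₀ (by positivity)]
    have h1 : √a ≤ √b := Real.sqrt_le_sqrt hab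
    have h2 : √b * 1 ≤ √b * (6 * (Lf / ν)) := by gcongr; linarith
    nlinarith
  exact explicit_bound_le_rate ha hb hLf hLh hσ.le hσh.le hκ hβ0 hx0 hy0
    (one_le_rpow_one_third hT) (cube_rpow_one_third T) (by positivity) (by positivity)
    (by positivity) hp.le hδ.le hxy' hyA hxi hyi hβi hβB hG hg hd (by positivity)

end Rate

end AdaHMM

/-! ### Assembly of the theorem. -/

theorem mainTheorem3
    (a b Lf Lh σ σh : ℝ) (ha : 0 < a) (hab : a ≤ b) (hLh : 0 ≤ Lh) (hσ : 0 ≤ σ) (hσh : 0 ≤ σh) :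
    -- the explicit bound
    (∀ (M₁ M₂ : ℕ) (Ω Ξ : Type*) [mΩ : MeasurableSpace Ω] [MeasurableSpace Ξ]
      (D : Measure Ξ) [IsProbabilityMeasure D] (μ : Measure Ω) [IsProbabilityMeasure μ]
      (ℱ : Filtration ℕ mΩ) (J : Joint M₁ M₂ → ℝ) (Q : Joint M₁ M₂ → Ξ → ℝ)
      (ν κ β μx μy lam : ℝ) (T : ℕ) (𝒯 : Trajectory M₁ M₂ Ω Ξ),
      0 < ν → ν ≤ Lf → κ = Lf / ν →
      0 < β → β ≤ 1 → 0 < μx → 0 < μy → μx ≤ √a * μy / (6 * √b * κ) → 1 ≤ T →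
      Assumptions J Q D μ ℱ ν Lf Lh σ σh a b β μx μy lam T 𝒯 →
      (∀ i < T, Integrable (gradNorms J 𝒯 i) μ) ∧
      avgGradNorm μ J T 𝒯 ≤
        3 * √b * startEnvelopeGap μ J 𝒯 / (μx * T)
        + 20 * √b * Lf * startDist μ J 𝒯 / (√a * T)
        + 60 * b * κ * startGap μ J 𝒯 / (√a * μy * T)
        + C₁ a b Lf κ * μx + C₂ a b Lf κ * μy
        + C₃ a b κ * (σ / (β * T) + Lh * (μx ^ 2 + μy ^ 2) / (2 * a * β)
            + √2 * σh * μy / √(β * a) + σ * √β)) ∧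
    -- the order of the constant `C₃`
    (∃ C : ℝ, 0 < C ∧ ∀ a' b' κ : ℝ, 0 < a' → a' ≤ b' → 1 ≤ κ →
      C₃ a' b' κ ≤ C * (κ * b' / a')) ∧
    -- the tuned parameters, the rate, and the sample complexity
    (0 < σ → 0 < σh → ∀ δ p : ℝ, 0 < δ → 0 < p →
      ∃ C : ℝ, 0 < C ∧ ∀ ν κ : ℝ, 0 < ν → ν ≤ Lf → κ = Lf / ν →
        (∀ T : ℕ, 1 ≤ T →
          betaTuned a b σ T ≤ C / (T : ℝ) ^ (2 / 3 : ℝ) ∧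
          muYTuned a b σ σh δ T ≤ C / (T : ℝ) ^ (2 / 3 : ℝ) ∧
          muXTuned a b σ σh δ p κ T ≤ C / (κ * (T : ℝ) ^ (2 / 3 : ℝ))) ∧
        (∀ T : ℕ, 1 ≤ T →
          ∀ (M₁ M₂ : ℕ) (Ω Ξ : Type*) [mΩ : MeasurableSpace Ω] [MeasurableSpace Ξ]
            (D : Measure Ξ) [IsProbabilityMeasure D] (μ : Measure Ω) [IsProbabilityMeasure μ]
            (ℱ : Filtration ℕ mΩ) (J : Joint M₁ M₂ → ℝ) (Q : Joint M₁ M₂ → Ξ → ℝ)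
            (lam : ℝ) (𝒯 : Trajectory M₁ M₂ Ω Ξ),
            Assumptions J Q D μ ℱ ν Lf Lh σ σh a b (betaTuned a b σ T)
              (muXTuned a b σ σh δ p κ T) (muYTuned a b σ σh δ T) lam T 𝒯 →
            startGap μ J 𝒯 ≤ δ → startEnvelopeGap μ J 𝒯 ≤ p →
            (∀ i < T, Integrable (gradNorms J 𝒯 i) μ) ∧
            avgGradNorm μ J T 𝒯 ≤ C * (κ / (T : ℝ) ^ (1 / 3 : ℝ))) ∧
        (∀ ε : ℝ, 0 < ε → ε ≤ 1 →
          ∃ T₀ : ℕ, 1 ≤ T₀ ∧ (sampleCount T₀ : ℝ) ≤ C * (κ ^ 3 * ε⁻¹ ^ 3) ∧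
          ∀ T : ℕ, T₀ ≤ T →
          ∀ (M₁ M₂ : ℕ) (Ω Ξ : Type*) [mΩ : MeasurableSpace Ω] [MeasurableSpace Ξ]
            (D : Measure Ξ) [IsProbabilityMeasure D] (μ : Measure Ω) [IsProbabilityMeasure μ]
            (ℱ : Filtration ℕ mΩ) (J : Joint M₁ M₂ → ℝ) (Q : Joint M₁ M₂ → Ξ → ℝ)
            (lam : ℝ) (𝒯 : Trajectory M₁ M₂ Ω Ξ),
            Assumptions J Q D μ ℱ ν Lf Lh σ σh a b (betaTuned a b σ T)
              (muXTuned a b σ σh δ p κ T) (muYTuned a b σ σh δ T) lam T 𝒯 →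
            startGap μ J 𝒯 ≤ δ → startEnvelopeGap μ J 𝒯 ≤ p →
            OutputStationary μ J T 𝒯 ε)) := by
  refine ⟨?_, ⟨168, by norm_num, fun a' b' κ ha' hab' hκ => C₃_order ha' hab' hκ⟩, ?_⟩
  · rintro M₁ M₂ Ω Ξ _ _ D _ μ _ ℱ J Q ν κ β μx μy lam T 𝒯 hν hνL rfl hβ hβ1 hμx hμy hμ hT h
    exact avgGradNorm_le hν hνL ha hab hLh hσ hσh hβ hβ1 hμx hμy hμ hT h
  · intro hσ hσh δ p hδ hp
    have hb : 0 < b := ha.trans_le hab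
    have hsa := Real.sqrt_pos.2 ha
    have hsb := Real.sqrt_pos.2 hb
    -- C is chosen before ν, so positivity of Lf is not yet available; if it fails there is no
    -- admissible ν.
    rcases le_or_gt Lf 0 with hLf | hLf
    · exact ⟨1, one_pos, fun ν κ hν hνL _ => absurd (hν.trans_le hνL) hLf.not_gt⟩
    have hK := tunedRateConst_pos ha hb hLh hLf hσ hσh hδ hp
    set K := tunedRateConst a b Lf Lh σ σh δ p with hKdef
    have hA : 0 < √σ * a / (σh * √b) := by
      have := Real.sqrt_pos.2 hσ
      positivity
    have hB : 0 < b * σ / a := by positivity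
    -- One summand per claim: K for the rate, K³ + 2 for the sample count (one unit for the ceiling,
    -- one for the initial sample), and the last two for the sizes of μy and β. The bound on μx
    -- follows from that on μy.
    set C := K + (K ^ 3 + 2) + √σ * a / (σh * √b) + b * σ / a with hC
    have hK3 : 0 < K ^ 3 := by positivity
    refine ⟨C, by positivity, ?_⟩
    rintro ν κ hν hνL rfl
    have hκ : 1 ≤ Lf / ν := (one_le_div hν).2 hνL
    have hκ0 : 0 < Lf / ν := by positivity
    refine ⟨fun T hT => ?_, ?_, ?_⟩
    · have hu1 := one_le_rpow_one_third hT
      have hu0 : 0 < (T : ℝ) ^ (1 / 3 : ℝ) := by linarith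
      obtain ⟨-, -, hβ, -⟩ := betaTuned_bounds ha hb hσ hT rfl
      obtain ⟨hy0, hy, -⟩ := muYTuned_bounds ha hb hσ hσh hδ hT rfl
      obtain ⟨-, hx, -⟩ := muXTuned_bounds ha hb hσ hσh hδ hp hκ hT rfl
      rw [rpow_two_thirds]
      have hy' : muYTuned a b σ σh δ T ≤ C / ((T : ℝ) ^ (1 / 3 : ℝ)) ^ 2 :=
        hy.trans (by gcongr; linarith)
      refine ⟨hβ.trans (by gcongr; linarith), hy', hx.trans ?_⟩
      have hab' : √a ≤ √b := Real.sqrt_le_sqrt hab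
      have hCn : 0 ≤ C := by positivity
      calc √a * muYTuned a b σ σh δ T / (6 * √b * (Lf / ν))
          ≤ √b * (C / ((T : ℝ) ^ (1 / 3 : ℝ)) ^ 2) / (6 * √b * (Lf / ν)) := by gcongr
        _ = 1 / 6 * (C / (Lf / ν * ((T : ℝ) ^ (1 / 3 : ℝ)) ^ 2)) := by field_simp
        _ ≤ C / (Lf / ν * ((T : ℝ) ^ (1 / 3 : ℝ)) ^ 2) := by
            have : 0 ≤ C / (Lf / ν * ((T : ℝ) ^ (1 / 3 : ℝ)) ^ 2) := by positivity
            linarith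
    · intro T hT M₁ M₂ Ω Ξ _ _ D _ μ _ ℱ J Q lam 𝒯 h hg hG
      obtain ⟨hint, havg⟩ := avgGradNorm_tuned_le ha hab hLh hσ hσh hδ hp hν hνL hT h hg hG
      exact ⟨hint, havg.trans (mul_le_mul_of_nonneg_right (by linarith) (by positivity))⟩
    · intro ε hε hε1
      have hpos : 0 < (K * (Lf / ν) / ε) ^ 3 := by positivity
      have hT₀ : 1 ≤ ⌈(K * (Lf / ν) / ε) ^ 3⌉₊ := Nat.ceil_pos.2 hpos
      -- The least T with Kκ/T^{1/3} ≤ ε. It is chosen with K rather than C so that C can absorb K³;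
      -- the additive 2 is absorbed because κ³ε⁻³ ≥ 1.
      refine ⟨⌈(K * (Lf / ν) / ε) ^ 3⌉₊, hT₀, ?_, ?_⟩
      · have h1 := (Nat.ceil_lt_add_one hpos.le).le
        have h2 : 1 ≤ (Lf / ν) ^ 3 * ε⁻¹ ^ 3 :=
          one_le_mul_of_one_le_of_one_le (one_le_pow₀ hκ)
            (one_le_pow₀ ((one_le_inv₀ hε).2 hε1))
        have h3 : (K * (Lf / ν) / ε) ^ 3 = K ^ 3 * ((Lf / ν) ^ 3 * ε⁻¹ ^ 3) := by
          rw [div_eq_mul_inv]; ring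
        have h4 : (K ^ 3 + 2) * ((Lf / ν) ^ 3 * ε⁻¹ ^ 3) ≤ C * ((Lf / ν) ^ 3 * ε⁻¹ ^ 3) :=
          mul_le_mul_of_nonneg_right (by linarith) (by positivity)
        rw [sampleCount, Nat.cast_add, Nat.cast_one]
        linarith
      · intro T hT₀T M₁ M₂ Ω Ξ _ _ D _ μ _ ℱ J Q lam 𝒯 h hg hG
        have hT : 1 ≤ T := hT₀.trans hT₀T
        obtain ⟨hint, havg⟩ := avgGradNorm_tuned_le ha hab hLh hσ hσh hδ hp hν hνL hT h hg hG
        refine outputStationary_of_avgGradNorm_le hT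
          (fun i hi => (measurable_gradNorms h.lipschitz h.loss h.run hi).1)
          (fun i hi => (measurable_gradNorms h.lipschitz h.loss h.run hi).2) hint (havg.trans ?_)
        have hu0 : 0 < (T : ℝ) ^ (1 / 3 : ℝ) :=
          one_pos.trans_le (one_le_rpow_one_third hT)
        have hle : K * (Lf / ν) / ε ≤ (T : ℝ) ^ (1 / 3 : ℝ) := by
          refine le_of_pow_le_pow_left₀ three_ne_zero hu0.le ?_
          rw [← cube_rpow_one_third]
          exact (Nat.le_ceil _).trans (by exact_mod_cast hT₀T)
        rw [← mul_div_assoc, div_le_iff₀ hu0]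
        rw [div_le_iff₀ hε] at hle
        linarith
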